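/- Let $\Gamma$ be a compact metric graph: finitely many vertices and edges, each edge $e$ a segment of finite length $L_e>0$ (loops and multiple edges allowed, connectedness not assumed). Let $V\in L_2(\Gamma)$ be a real potential and let $v$ be a vertex incident to at least one edge. For a function $f$ that belongs to $H^2(e)$ on every edge, let $F(w)$ and $F'(w)$ be the vectors of values and of derivatives of $f$ at a vertex $w$ along the edge ends attached to $w$, derivatives being taken away from $w$ and into the edges; let $\sum f'(v)$ be the sum of the entries of $F'(v)$. At each vertex $w\ne v$ fix arbitrary self-adjoint conditions $A_wF(w)+B_wF'(w)=0$, where $A_w,B_w$ are $d_w\times d_w$ complex matrices, $d_w$ is the degree of $w$, $(A_w\,B_w)$ has maximal rank and $A_wB_w^*$ is self-adjoint. For real $\alpha$ let $\mathcal H_\alpha$ be the operator acting as $-\frac{d^2}{dx^2}+V$ on each edge, on the functions in $\bigoplus_e H^2(e)$ that satisfy these conditions at all $w\neq v$ and, at $v$, the $\delta$-type condition: $f$ is continuous at $v$ and $\sum f'(v)=\alpha f(v)$. For real $\zeta$ let $\widetilde{\mathcal H}_\zeta$ be the same operator with the condition at $v$ replaced by: $f$ is continuous at $v$ and $\zeta\sum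 f'(v)=-f(v)$ (so $\zeta=0$ is the Dirichlet condition, and $\alpha=-1/\zeta$ for $\zeta\neq0$). A branch of simple eigenvalues of one of these families is a continuous real function $\lambda$ on an open set of parameters whose value at each parameter $t$ is a simple eigenvalue of the operator with parameter $t$. Then: 1. If $\lambda_0$ is a simple eigenvalue of $\mathcal H_{\alpha_0}$, there is a branch $\lambda(\alpha)$ of simple eigenvalues of $\mathcal H_\alpha$, defined on an open set containing $\alpha_0$, with $\lambda(\alpha_0)=\lambda_0$. Every branch $\lambda(\alpha)$ of simple eigenvalues of $\mathcal H_\alpha$ is differentiable, and $$\frac{d\lambda}{d\alpha}=|f(v)|^2,$$ where $f$ is any $L_2(\Gamma)$-normalized eigenfunction of $\mathcal H_\alpha$ with eigenvalue $\lambda(\alpha)$. 2. If $\lambda_0$ is a simple eigenvalue of $\widetilde{\mathcal H}_{\zeta_0}$ ($\zeta_0=0$ allowed), there is a branch $\lambda(\zeta)$ of simple eigenvalues of $\widetilde{\mathcal H}_\zeta$, defined on an open set containing $\zeta_0$, with $\lambda(\zeta_0)=\lambda_0$. Every branch $\lambda(\zeta)$ of simple eigenvalues of $\widetilde{\mathcal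 H}_\zeta$ is differentiable, also at $\zeta=0$, and $$\frac{d\lambda}{d\zeta}=\Bigl|\sum f'(v)\Bigr|^2,$$ where $f$ is any $L_2(\Gamma)$-normalized eigenfunction of $\widetilde{\mathcal H}_\zeta$ with eigenvalue $\lambda(\zeta)$. -/

import Mathlib

open MeasureTheory Set
open scoped ContDiff Matrix

/-- A compact metric graph (loops and multiple edges allowed, connectedness not required):
the edge `e` is the segment `[0, len e]`, whose end `0` is attached to the vertex `src e` and
whose end `len e` is attached to the vertex `tgt e`. -/
structure MetricGraph (𝒱 ℰ : Type*) where
  src : ℰ → 𝒱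
  tgt : ℰ → 𝒱
  len : ℰ → ℝ
  len_pos : ∀ e, 0 < len e

/-- `w` is a weak derivative of `u` on the interval `(0, ℓ)`. -/
def HasWeakDerivOn (ℓ : ℝ) (u w : ℝ → ℂ) : Prop :=
  ∀ φ : ℝ → ℝ, ContDiff ℝ ∞ φ → HasCompactSupport φ → tsupport φ ⊆ Ioo 0 ℓ →
    ∫ x in Ioo 0 ℓ, ((deriv φ x : ℝ) : ℂ) * u x = - ∫ x in Ioo 0 ℓ, ((φ x : ℝ) : ℂ) * w x

/-- Self-adjoint vertex conditions `A F + B F' = 0` at a vertex whose edge ends are indexed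
by `ι`: the block matrix `(A B)` has maximal rank and `A B*` is self-adjoint. -/
structure SelfAdjointCondition (ι : Type*) [Fintype ι] where
  A : Matrix ι ι ℂ
  B : Matrix ι ι ℂ
  rank_eq : (Matrix.fromCols A B).rank = Fintype.card ι
  selfAdjoint : (A * Bᴴ).IsHermitian

namespace MetricGraph

variable {𝒱 ℰ : Type*} (G : MetricGraph 𝒱 ℰ)

/-- The vertex to which an edge end is attached; `(e, false)` is the end `0` of the edge `e`
and `(e, true)` is its end `len e`. -/
def endVertex (b : ℰ × Bool) : 𝒱 := if b.2 then G.tgt b.1 else G.src b.1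

/-- The edge ends attached to the vertex `w` (a loop at `w` contributes both of its ends). -/
abbrev Ends (w : 𝒱) : Type _ := {b : ℰ × Bool // G.endVertex b = w}

/-- An element of `⨁ₑ H²(e)`, with its first and second weak derivatives. As `H²` embeds
into `C¹` on the closed edge, the function and its first derivative are given by their
continuous representatives on `[0, len e]`; values outside `[0, len e]` have no meaning. -/
structure H2Function where
  toFun : ℰ → ℝ → ℂ
  der : ℰ → ℝ → ℂ
  der2 : ℰ → ℝ → ℂ
  continuousOn : ∀ e, ContinuousOn (toFun e) (Icc 0 (G.len e))
  der_continuousOn : ∀ e, ContinuousOn (der e) (Icc 0 (G.len e))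
  der2_memLp : ∀ e, MemLp (der2 e) 2 (volume.restrict (Ioo 0 (G.len e)))
  weakDeriv : ∀ e, HasWeakDerivOn (G.len e) (toFun e) (der e)
  weakDeriv2 : ∀ e, HasWeakDerivOn (G.len e) (der e) (der2 e)

variable {G}

/-- The value of `f` at an edge end. -/
def H2Function.value (f : G.H2Function) (b : ℰ × Bool) : ℂ :=
  if b.2 then f.toFun b.1 (G.len b.1) else f.toFun b.1 0

/-- The derivative of `f` at an edge end, taken away from the vertex and into the edge. -/
def H2Function.inwardDeriv (f : G.H2Function) (b : ℰ × Bool) : ℂ :=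
  if b.2 then -f.der b.1 (G.len b.1) else f.der b.1 0

section Conditions

variable [DecidableEq 𝒱] [Fintype ℰ]

/-- The sum over all edge ends at `w` of the derivatives of `f` directed into the edges. -/
noncomputable def H2Function.sumDeriv (f : G.H2Function) (w : 𝒱) : ℂ :=
  ∑ b : G.Ends w, f.inwardDeriv b

/-- `f` satisfies the vertex condition `A F(w) + B F'(w) = 0`. -/
def H2Function.Satisfies (f : G.H2Function) {w : 𝒱} (c : SelfAdjointCondition (G.Ends w)) :
    Prop :=
  c.A *ᵥ (fun b => f.value b) + c.B *ᵥ (fun b => f.inwardDeriv b) = 0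

/-- The domain of the Hamiltonian with the fixed conditions `C` at the vertices other than `v`
and the `δ`-type condition at `v`: `f` is continuous at `v` and `∑ f'(v) = α f(v)`. -/
def deltaDomain (v : 𝒱) (C : ∀ w, w ≠ v → SelfAdjointCondition (G.Ends w)) (α : ℝ)
    (f : G.H2Function) : Prop :=
  (∀ w (hw : w ≠ v), f.Satisfies (C w hw)) ∧
    ∃ fv : ℂ, (∀ b : G.Ends v, f.value b = fv) ∧ f.sumDeriv v = (α : ℂ) * fv

/-- The same with the reparametrised condition at `v`: `f` is continuous at `v` and
`ζ ∑ f'(v) = -f(v)`. -/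
def zetaDomain (v : 𝒱) (C : ∀ w, w ≠ v → SelfAdjointCondition (G.Ends w)) (ζ : ℝ)
    (f : G.H2Function) : Prop :=
  (∀ w (hw : w ≠ v), f.Satisfies (C w hw)) ∧
    ∃ fv : ℂ, (∀ b : G.Ends v, f.value b = fv) ∧ (ζ : ℂ) * f.sumDeriv v = -fv

/-- `f` has norm one in `L²(Γ)`. -/
def H2Function.Normalized (f : G.H2Function) : Prop :=
  ∑ e, ∫ x in Ioo 0 (G.len e), ‖f.toFun e x‖ ^ 2 = 1

end Conditions

/-- The operator with domain `D` acting as `-d²/dx² + V` on each edge satisfies `H f = μ f`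
(that is, `f` is in the eigenspace of `μ`; `f = 0` is allowed). -/
def InEigenspace (V : ℰ → ℝ → ℝ) (D : G.H2Function → Prop) (μ : ℝ) (f : G.H2Function) : Prop :=
  D f ∧ ∀ e, ∀ᵐ x ∂(volume.restrict (Ioo 0 (G.len e))),
    -f.der2 e x + (V e x : ℂ) * f.toFun e x = (μ : ℂ) * f.toFun e x

/-- `μ` is a simple eigenvalue: its eigenspace is one-dimensional, i.e. spanned by some nonzero
function (functions on the graph being compared on the edges `[0, len e]` only). -/
def IsSimpleEigenvalue (V : ℰ → ℝ → ℝ) (D : G.H2Function → Prop) (μ : ℝ) : Prop :=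
  ∃ f : G.H2Function, InEigenspace V D μ f ∧
    (∃ e, ∃ x ∈ Icc 0 (G.len e), f.toFun e x ≠ 0) ∧
    ∀ g : G.H2Function, InEigenspace V D μ g →
      ∃ c : ℂ, ∀ e, ∀ x ∈ Icc 0 (G.len e), g.toFun e x = c * f.toFun e x

/-- `lam` is a branch of simple eigenvalues, over the open set `U` of parameters, of the family
of operators `-d²/dx² + V` with domains `D t`. -/
def IsSimpleBranch (V : ℰ → ℝ → ℝ) (D : ℝ → G.H2Function → Prop) (U : Set ℝ) (lam : ℝ → ℝ) :
    Prop :=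
  IsOpen U ∧ ContinuousOn lam U ∧ ∀ t ∈ U, IsSimpleEigenvalue V (D t) (lam t)

end MetricGraph

/-! The eigenvalue problem is turned into a finite linear system with an extra unknown. Let `f` be
an eigenfunction for the simple eigenvalue `c` at the parameter `t₀`, put `h = f` and `N = ‖f‖²`. On
every edge solve `-u'' + V u = lam u + m h` with free initial values at the end `0`; the unknowns
are these `2|E|` numbers and the scalar `m`. Impose the `2|E|` vertex conditions at the parameter
`t` and the normalisation `⟨h, u⟩ = N`. Simplicity makes this square system uniquely solvable at
`(c, t₀)`, hence also nearby, with a solution continuous in `(lam, t)`. In this neighbourhood `lam`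
is an eigenvalue at `t` exactly when `m(lam, t) = 0`, and it is then automatically simple.

Everything else follows from Green's identity for the solutions at `(lam, t)` and `(lam', t')`: `(t
- t') conj(q') q = (lam - lam') ⟨u', u⟩ + (m - conj m') N`, where `q` is `f(v)` for the δ-family and
`∑ f'(v)` for the ζ-family. Equal parameters give that `m` is real. Equal `t` gives that `m` is
strictly decreasing in `lam` near `c`, so the intermediate value theorem yields a continuous root
`lam(t)`. Along any branch both `m` vanish, and division by `t - t'` gives the derivative `|q|² /
N`. Nothing is divided by `ζ`, so `ζ = 0` is not exceptional.

Three ingredients carry this: `HasWeakDerivOn.isPrimitiveOn` (weak derivatives of continuous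
functions can be integrated), `isUnit_one_sub_integrate_volterra` (the initial value problem with an
integrable potential) and `SelfAdjointCondition.green` (self-adjoint conditions contribute nothing
to Green's identity). They are assembled in `BorderedFamily` and `VertexFamily`. -/

/-! ### Absolutely continuous functions and integration by parts -/

/-- `F` is an absolutely continuous function on `[0, ℓ]` with derivative `f`. -/
def IsPrimitiveOn (ℓ : ℝ) (F f : ℝ → ℂ) : Prop :=
  IntervalIntegrable f volume 0 ℓ ∧ ∀ x ∈ Icc 0 ℓ, F x = F 0 + ∫ s in (0 : ℝ)..x, f s

/-- Fubini: the two iterated integrals are those of `f(x) g(y)` over the triangles `y ≤ x` and `x ≤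
y`, which cover the square and overlap only in the null diagonal. This is integration by parts for
primitives vanishing at `0`. -/
theorem intervalIntegral_mul_primitive_add {ℓ : ℝ} (hℓ : 0 ≤ ℓ) {f g : ℝ → ℂ}
    (hf : IntervalIntegrable f volume 0 ℓ) (hg : IntervalIntegrable g volume 0 ℓ) :
    (∫ x in (0 : ℝ)..ℓ, f x * ∫ y in (0 : ℝ)..x, g y) +
      (∫ y in (0 : ℝ)..ℓ, (∫ x in (0 : ℝ)..y, f x) * g y) =
      (∫ x in (0 : ℝ)..ℓ, f x) * ∫ y in (0 : ℝ)..ℓ, g y := by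
  rw [intervalIntegrable_iff_integrableOn_Ioc_of_le hℓ] at hf hg
  set μ := volume.restrict (Ioc 0 ℓ) with hμ
  have key : ∀ (h : ℝ → ℂ), ∀ x ∈ Ioc 0 ℓ,
      ∫ y in (0 : ℝ)..x, h y = ∫ y, (if y ≤ x then h y else 0) ∂μ := by
    intro h x hx
    rw [intervalIntegral.integral_of_le hx.1.le, hμ]
    have : (fun y => if y ≤ x then h y else 0) = (Iic x).indicator h := by
      ext y; simp [indicator_apply]
    rw [this, setIntegral_indicator measurableSet_Iic]
    congr 2
    ext y; simp only [mem_Ioc, mem_inter_iff, mem_Iic]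
    constructor
    · rintro ⟨h1, h2⟩; exact ⟨⟨h1, h2.trans hx.2⟩, h2⟩
    · rintro ⟨⟨h1, _⟩, h2⟩; exact ⟨h1, h2⟩
  have hprod : Integrable (fun z : ℝ × ℝ => f z.1 * g z.2) (μ.prod μ) := hf.mul_prod hg
  have hm1 : MeasurableSet {z : ℝ × ℝ | z.2 ≤ z.1} :=
    measurableSet_le measurable_snd measurable_fst
  have hm2 : MeasurableSet {z : ℝ × ℝ | z.1 ≤ z.2} :=
    measurableSet_le measurable_fst measurable_snd
  have hi1 := hprod.indicator hm1
  have hi2 := hprod.indicator hm2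
  have e1 : (∫ x in (0 : ℝ)..ℓ, f x * ∫ y in (0 : ℝ)..x, g y) =
      ∫ x, ∫ y, ({z : ℝ × ℝ | z.2 ≤ z.1}.indicator
        (fun z : ℝ × ℝ => f z.1 * g z.2)) (x, y) ∂μ ∂μ := by
    rw [intervalIntegral.integral_of_le hℓ]
    refine setIntegral_congr_fun measurableSet_Ioc fun x hx => ?_
    simp only [key g x hx]
    rw [← integral_const_mul]
    refine integral_congr_ae (Filter.Eventually.of_forall fun y => ?_)
    simp [indicator_apply]
  have e2 : (∫ y in (0 : ℝ)..ℓ, (∫ x in (0 : ℝ)..y, f x) * g y) =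
      ∫ x, ∫ y, ({z : ℝ × ℝ | z.1 ≤ z.2}.indicator
        (fun z : ℝ × ℝ => f z.1 * g z.2)) (x, y) ∂μ ∂μ := by
    rw [integral_integral_swap (by exact hi2), intervalIntegral.integral_of_le hℓ]
    refine setIntegral_congr_fun measurableSet_Ioc fun y hy => ?_
    simp only [key f y hy]
    rw [← integral_mul_const]
    refine integral_congr_ae (Filter.Eventually.of_forall fun x => ?_)
    simp [indicator_apply]
  have e3 : (∫ x in (0 : ℝ)..ℓ, f x) * (∫ y in (0 : ℝ)..ℓ, g y) =
      ∫ z, f z.1 * g z.2 ∂(μ.prod μ) := by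
    rw [integral_prod_mul, intervalIntegral.integral_of_le hℓ, intervalIntegral.integral_of_le hℓ]
  rw [e1, e2, e3, ← integral_prod _ (by simpa using hi1), ← integral_prod _ (by simpa using hi2),
    ← integral_add hi1 hi2]
  refine integral_congr_ae ?_
  have hdiag : ∀ᵐ z ∂(μ.prod μ), z.1 ≠ z.2 := by
    rw [Measure.ae_prod_iff_ae_ae]
    · refine Filter.Eventually.of_forall fun x => ?_
      have : ∀ᵐ y ∂μ, y ≠ x := by
        rw [ae_iff]; simp
      filter_upwards [this] with y hy using hy.symm
    · exact (measurableSet_eq_fun measurable_fst measurable_snd).compl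
  filter_upwards [hdiag] with z hz
  simp only [indicator_apply, mem_ofPred_eq]
  rcases lt_or_gt_of_ne hz with h | h
  · simp [h.le, not_le.2 h]
  · simp [h.le, not_le.2 h]

theorem IsPrimitiveOn.continuousOn {ℓ : ℝ} (hℓ : 0 ≤ ℓ) {F f : ℝ → ℂ} (h : IsPrimitiveOn ℓ F f) :
    ContinuousOn F (Icc 0 ℓ) := by
  have h1 := intervalIntegral.continuousOn_primitive_interval' h.1 (left_mem_uIcc)
  rw [uIcc_of_le hℓ] at h1
  exact (continuousOn_const.add h1).congr h.2

/-- Integration by parts for absolutely continuous functions. -/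
theorem IsPrimitiveOn.integral_mul_add {ℓ : ℝ} (hℓ : 0 ≤ ℓ) {F G f g : ℝ → ℂ}
    (hF : IsPrimitiveOn ℓ F f) (hG : IsPrimitiveOn ℓ G g) :
    ∫ x in (0 : ℝ)..ℓ, (f x * G x + F x * g x) = F ℓ * G ℓ - F 0 * G 0 := by
  have hFc : ContinuousOn F (uIcc 0 ℓ) := by rw [uIcc_of_le hℓ]; exact hF.continuousOn hℓ
  have hGc : ContinuousOn G (uIcc 0 ℓ) := by rw [uIcc_of_le hℓ]; exact hG.continuousOn hℓ
  have hGp := intervalIntegral.continuousOn_primitive_interval' hG.1 (left_mem_uIcc)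
  have hFp := intervalIntegral.continuousOn_primitive_interval' hF.1 (left_mem_uIcc)
  rw [intervalIntegral.integral_add (hF.1.mul_continuousOn hGc) (hG.1.continuousOn_mul hFc)]
  have h1 : ∫ x in (0 : ℝ)..ℓ, f x * G x =
      (∫ x in (0 : ℝ)..ℓ, f x) * G 0 + ∫ x in (0 : ℝ)..ℓ, f x * ∫ y in (0 : ℝ)..x, g y := by
    rw [← intervalIntegral.integral_mul_const, ← intervalIntegral.integral_add
      (hF.1.mul_const _) (hF.1.mul_continuousOn hGp)]
    refine intervalIntegral.integral_congr fun x hx => ?_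
    rw [uIcc_of_le hℓ] at hx
    simp only [hG.2 x hx]; ring
  have h2 : ∫ x in (0 : ℝ)..ℓ, F x * g x =
      F 0 * (∫ x in (0 : ℝ)..ℓ, g x) + ∫ x in (0 : ℝ)..ℓ, (∫ y in (0 : ℝ)..x, f y) * g x := by
    rw [← intervalIntegral.integral_const_mul, ← intervalIntegral.integral_add
      (hG.1.const_mul _) (hG.1.continuousOn_mul hFp)]
    refine intervalIntegral.integral_congr fun x hx => ?_
    rw [uIcc_of_le hℓ] at hx
    simp only [hF.2 x hx]; ring
  have h3 := intervalIntegral_mul_primitive_add hℓ hF.1 hG.1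
  rw [h1, h2, hF.2 ℓ ⟨hℓ, le_rfl⟩, hG.2 ℓ ⟨hℓ, le_rfl⟩]
  linear_combination h3

theorem IsPrimitiveOn.star {ℓ : ℝ} {F f : ℝ → ℂ} (hF : IsPrimitiveOn ℓ F f) :
    IsPrimitiveOn ℓ (fun x => starRingEnd ℂ (F x)) (fun x => starRingEnd ℂ (f x)) := by
  refine ⟨⟨?_, ?_⟩, fun x hx => ?_⟩
  · exact (Complex.conjLIE.toContinuousLinearEquiv.toContinuousLinearMap).integrable_comp hF.1.1
  · exact (Complex.conjLIE.toContinuousLinearEquiv.toContinuousLinearMap).integrable_comp hF.1.2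
  · simp only [hF.2 x hx, map_add]
    rw [intervalIntegral, intervalIntegral, map_sub, integral_conj, integral_conj]

theorem isPrimitiveOn_of_contDiff {φ : ℝ → ℝ} (hφ : ContDiff ℝ ∞ φ) (ℓ : ℝ) :
    IsPrimitiveOn ℓ (fun x => (φ x : ℂ)) (fun x => ((deriv φ x : ℝ) : ℂ)) := by
  have hc : Continuous (deriv φ) := (contDiff_infty_iff_deriv.1 hφ).2.continuous
  refine ⟨(Complex.continuous_ofReal.comp hc).intervalIntegrable _ _, fun x _ => ?_⟩
  rw [intervalIntegral.integral_ofReal, intervalIntegral.integral_deriv_eq_sub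
    (fun y _ => (contDiff_infty_iff_deriv.1 hφ).1 y) (hc.intervalIntegrable _ _)]
  push_cast; ring

/-- Integration by parts against a test function, whose support avoids both ends and so leaves no
boundary terms. -/
theorem IsPrimitiveOn.hasWeakDerivOn {ℓ : ℝ} (hℓ : 0 ≤ ℓ) {F f : ℝ → ℂ}
    (hF : IsPrimitiveOn ℓ F f) : HasWeakDerivOn ℓ F f := by
  intro φ hφ _ hsupp
  have hφ' := isPrimitiveOn_of_contDiff hφ ℓ
  have h := hφ'.integral_mul_add hℓ hF
  have h0 : φ 0 = 0 := image_eq_zero_of_notMem_tsupport fun h => lt_irrefl _ (hsupp h).1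
  have h1 : φ ℓ = 0 := image_eq_zero_of_notMem_tsupport fun h => lt_irrefl _ (hsupp h).2
  have hFc : ContinuousOn F (uIcc 0 ℓ) := by rw [uIcc_of_le hℓ]; exact hF.continuousOn hℓ
  have hφc : ContinuousOn (fun x => (φ x : ℂ)) (uIcc 0 ℓ) :=
    (Complex.continuous_ofReal.comp hφ.continuous).continuousOn
  rw [intervalIntegral.integral_add (hφ'.1.mul_continuousOn hFc) (hF.1.continuousOn_mul hφc),
    h0, h1, intervalIntegral.integral_of_le hℓ, intervalIntegral.integral_of_le hℓ,
    integral_Ioc_eq_integral_Ioo, integral_Ioc_eq_integral_Ioo] at h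
  rw [Complex.ofReal_zero, zero_mul, zero_mul, sub_zero] at h
  linear_combination h

/-! ### Weak derivatives and the du Bois-Reymond lemma -/

theorem exists_Icc_of_isCompact_subset_Ioo {ℓ : ℝ} {K : Set ℝ} (hK : IsCompact K)
    (hKs : K ⊆ Ioo 0 ℓ) (hℓ : 0 < ℓ) : ∃ a b, 0 < a ∧ b < ℓ ∧ K ⊆ Icc a b := by
  rcases K.eq_empty_or_nonempty with rfl | hne
  · exact ⟨ℓ / 2, ℓ / 2, by linarith, by linarith, empty_subset _⟩
  · obtain ⟨a, ha⟩ := hK.exists_isLeast hne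
    obtain ⟨b, hb⟩ := hK.exists_isGreatest hne
    exact ⟨a, b, (hKs ha.1).1, (hKs hb.1).2, fun x hx => ⟨ha.2 hx, hb.2 hx⟩⟩

/-- A test function with vanishing integral is the derivative of a test function. -/
theorem exists_testFunction_primitive {ℓ : ℝ} (hℓ : 0 < ℓ) {ψ : ℝ → ℝ} (hψ : ContDiff ℝ ∞ ψ)
    (hc : HasCompactSupport ψ) (hs : tsupport ψ ⊆ Ioo 0 ℓ)
    (h0 : ∫ x in (0 : ℝ)..ℓ, ψ x = 0) :
    ∃ φ : ℝ → ℝ, ContDiff ℝ ∞ φ ∧ HasCompactSupport φ ∧ tsupport φ ⊆ Ioo 0 ℓ ∧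
      deriv φ = ψ := by
  obtain ⟨a, b, ha, hb, hab⟩ := exists_Icc_of_isCompact_subset_Ioo hc hs hℓ
  have hz : ∀ x, x ∉ Icc a b → ψ x = 0 := fun x hx =>
    image_eq_zero_of_notMem_tsupport fun h => hx (hab h)
  have hcont := hψ.continuous
  set φ : ℝ → ℝ := fun x => ∫ s in (0 : ℝ)..x, ψ s with hφ
  have hd : ∀ x, HasDerivAt φ (ψ x) x := fun x =>
    intervalIntegral.integral_hasDerivAt_right (hcont.intervalIntegrable _ _)
      (hcont.stronglyMeasurableAtFilter _ _) hcont.continuousAt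
  have hd' : deriv φ = ψ := funext fun x => (hd x).deriv
  have hsupp : tsupport φ ⊆ Icc a b := by
    refine closure_minimal (fun x hx => ?_) isClosed_Icc
    by_contra hx'
    refine hx ?_
    rw [mem_Icc, not_and_or, not_le, not_le] at hx'
    rcases hx' with h | h
    · refine (intervalIntegral.integral_congr (g := fun _ => (0 : ℝ)) fun s hs => ?_).trans
        (by simp)
      refine hz s fun h' => ?_
      have := hs.2
      have h3 : max 0 x < a := max_lt ha h
      linarith [h'.1]
    -- To the right of the support of `ψ` the primitive equals the total integral, which is zero by
    -- `h0`.
    · have : φ x = (∫ s in (0 : ℝ)..ℓ, ψ s) + ∫ s in ℓ..x, ψ s :=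
        (intervalIntegral.integral_add_adjacent_intervals (hcont.intervalIntegrable _ _)
          (hcont.intervalIntegrable _ _)).symm
      rw [this, h0, zero_add]
      refine (intervalIntegral.integral_congr (g := fun _ => (0 : ℝ)) fun s hs => ?_).trans
        (by simp)
      refine hz s fun h' => ?_
      have := hs.1
      have h3 : b < min ℓ x := lt_min hb h
      linarith [h'.2]
  refine ⟨φ, ?_, ?_, hsupp.trans fun x hx => ⟨ha.trans_le hx.1, hx.2.trans_lt hb⟩, hd'⟩
  · rw [contDiff_infty_iff_deriv, hd']
    exact ⟨fun x => (hd x).differentiableAt, hψ⟩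
  · exact isCompact_Icc.of_isClosed_subset (isClosed_tsupport _) hsupp

/-- The du Bois-Reymond lemma. -/
theorem HasWeakDerivOn.const_of_zero {ℓ : ℝ} (hℓ : 0 < ℓ) {h : ℝ → ℂ}
    (hc : ContinuousOn h (Icc 0 ℓ)) (hw : HasWeakDerivOn ℓ h 0) :
    ∀ x ∈ Icc 0 ℓ, h x = h 0 := by
  obtain ⟨ρ, hρ, hρc, hρs, hρ1⟩ : ∃ ρ : ℝ → ℝ, ContDiff ℝ ∞ ρ ∧ HasCompactSupport ρ ∧
      tsupport ρ ⊆ Ioo 0 ℓ ∧ ∫ x in (0 : ℝ)..ℓ, ρ x = 1 := by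
    let B : ContDiffBump (ℓ / 2) := ⟨ℓ / 8, ℓ / 4, by linarith, by linarith⟩
    have hsub : tsupport (B.normed volume) ⊆ Ioo 0 ℓ := by
      rw [B.tsupport_normed_eq, Real.closedBall_eq_Icc]
      intro x hx
      have h1 := hx.1
      have h2 := hx.2
      change ℓ / 2 - ℓ / 4 ≤ x at h1
      change x ≤ ℓ / 2 + ℓ / 4 at h2
      constructor <;> linarith
    refine ⟨B.normed volume, B.contDiff_normed, B.hasCompactSupport_normed, hsub, ?_⟩
    rw [intervalIntegral.integral_of_le hℓ.le, setIntegral_eq_integral_of_forall_compl_eq_zero,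
      B.integral_normed]
    intro x hx
    exact image_eq_zero_of_notMem_tsupport fun h => hx (Ioo_subset_Ioc_self (hsub h))
  set c : ℂ := ∫ x in Ioo 0 ℓ, (ρ x : ℂ) * h x with hcdef
  have hint : ∀ ψ : ℝ → ℝ, Continuous ψ → IntegrableOn (fun x => (ψ x : ℂ) * h x) (Ioo 0 ℓ) := by
    intro ψ hψ
    exact (((Complex.continuous_ofReal.comp hψ).continuousOn.mul hc).integrableOn_Icc).mono_set
      Ioo_subset_Icc_self
  have hzero : ∀ᵐ x, x ∈ Ioo 0 ℓ → h x - c = 0 := by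
    refine isOpen_Ioo.ae_eq_zero_of_integral_contDiff_smul_eq_zero
      (f := fun x => h x - c) ?_ fun ψ hψ hψc hψs => ?_
    · exact ((hc.sub continuousOn_const).integrableOn_Icc.mono_set
        Ioo_subset_Icc_self).locallyIntegrableOn
    -- Subtracting `m ρ` makes the integral of `ψ` zero, so `ψ - m ρ` is the derivative of a test
    -- function and is annihilated by `h`. Thus `∫ ψ h = m c`, that is, `h - c` annihilates every
    -- test function.
    · set m : ℝ := ∫ x in (0 : ℝ)..ℓ, ψ x with hm
      have hmul : ContDiff ℝ ∞ fun x => m * ρ x := contDiff_const.mul hρ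
      have hs : tsupport (fun x => ψ x - m * ρ x) ⊆ Ioo 0 ℓ := by
        refine (tsupport_sub _ _).trans (union_subset hψs ?_)
        exact (tsupport_mul_subset_right).trans hρs
      obtain ⟨φ, h1, h2, h3, h4⟩ := exists_testFunction_primitive hℓ (hψ.sub hmul)
        (hψc.sub hρc.mul_left) hs (by
          rw [intervalIntegral.integral_sub (hψ.continuous.intervalIntegrable _ _)
            (hmul.continuous.intervalIntegrable _ _), intervalIntegral.integral_const_mul, hρ1,
            ← hm]
          ring)
      have h5 := hw φ h1 h2 h3
      simp only [h4, Pi.zero_apply, mul_zero, integral_zero, neg_zero] at h5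
      have h6 : ∫ x in Ioo 0 ℓ, (ψ x : ℂ) * h x = m * c := by
        rw [hcdef, ← integral_const_mul, ← sub_eq_zero, ← integral_sub (hint _ hψ.continuous)
          ((hint _ hρ.continuous).const_mul _), ← h5]
        refine integral_congr_ae (Filter.Eventually.of_forall fun x => ?_)
        simp only; push_cast; ring
      have h7 : (∫ x in Ioo 0 ℓ, (ψ x : ℂ)) = m := by
        rw [hm, ← intervalIntegral.integral_ofReal, intervalIntegral.integral_of_le hℓ.le,
          integral_Ioc_eq_integral_Ioo]
      rw [← setIntegral_eq_integral_of_forall_compl_eq_zero (s := Ioo 0 ℓ) (fun x hx => by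
        rw [image_eq_zero_of_notMem_tsupport fun h => hx (hψs h), zero_smul])]
      have h8 : ∀ x, ψ x • (h x - c) = (ψ x : ℂ) * h x - (ψ x : ℂ) * c := fun x => by
        rw [Complex.real_smul]; ring
      simp_rw [h8]
      rw [integral_sub (hint _ hψ.continuous), h6, integral_mul_const, h7, sub_self]
      exact (((Complex.continuous_ofReal.comp hψ.continuous).mul
        continuous_const).integrableOn_Icc (a := 0) (b := ℓ)).mono_set Ioo_subset_Icc_self
  have hae : h =ᵐ[volume.restrict (Icc 0 ℓ)] fun _ => c := by
    rw [Filter.EventuallyEq, ← Measure.restrict_congr_set (Ioo_ae_eq_Icc (a := (0:ℝ)) (b := ℓ)),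
      ae_restrict_iff' measurableSet_Ioo]
    filter_upwards [hzero] with x hx h' using sub_eq_zero.1 (hx h')
  have hEq := Measure.eqOn_Icc_of_ae_eq volume hℓ.ne hae hc continuousOn_const
  intro x hx
  rw [hEq hx, hEq ⟨le_rfl, hℓ.le⟩]

/-- A continuous function with an integrable weak derivative is absolutely continuous. -/
theorem HasWeakDerivOn.isPrimitiveOn {ℓ : ℝ} (hℓ : 0 < ℓ) {u w : ℝ → ℂ}
    (hc : ContinuousOn u (Icc 0 ℓ)) (hw : IntervalIntegrable w volume 0 ℓ)
    (h : HasWeakDerivOn ℓ u w) : IsPrimitiveOn ℓ u w := by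
  refine ⟨hw, fun x hx => ?_⟩
  have hP : IsPrimitiveOn ℓ (fun x => ∫ s in (0 : ℝ)..x, w s) w := ⟨hw, fun x _ => by simp⟩
  have hPw := hP.hasWeakDerivOn hℓ.le
  have hPc := hP.continuousOn hℓ.le
  -- The difference of `u` and the primitive of `w` has weak derivative zero, hence is constant.
  have hd : HasWeakDerivOn ℓ (fun x => u x - ∫ s in (0 : ℝ)..x, w s) 0 := by
    intro φ h1 h2 h3
    have hcd : Continuous (fun x => ((deriv φ x : ℝ) : ℂ)) :=
      Complex.continuous_ofReal.comp (contDiff_infty_iff_deriv.1 h1).2.continuous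
    have hi : ∀ F : ℝ → ℂ, ContinuousOn F (Icc 0 ℓ) →
        IntegrableOn (fun x => ((deriv φ x : ℝ) : ℂ) * F x) (Ioo 0 ℓ) := fun F hF =>
      ((hcd.continuousOn.mul hF).integrableOn_Icc).mono_set Ioo_subset_Icc_self
    simp only [mul_sub, Pi.zero_apply, mul_zero, integral_zero, neg_zero]
    rw [integral_sub (hi _ hc) (hi _ hPc), h φ h1 h2 h3, hPw φ h1 h2 h3, sub_self]
  have h0 := hd.const_of_zero hℓ (hc.sub hPc) x hx
  simp only [Pi.sub_apply, intervalIntegral.integral_same, sub_zero] at h0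
  rw [← h0]; ring

/-! ### Volterra operators on an edge -/

section Volterra

variable {ℓ : ℝ}

/-- The Banach space of continuous functions on `[0, ℓ]`. -/
def EdgeFun (ℓ : ℝ) : Type := C(Icc 0 ℓ, ℂ)

noncomputable instance : NormedAddCommGroup (EdgeFun ℓ) :=
  inferInstanceAs (NormedAddCommGroup C(Icc 0 ℓ, ℂ))

noncomputable instance : NormedSpace ℂ (EdgeFun ℓ) := inferInstanceAs (NormedSpace ℂ C(Icc 0 ℓ, ℂ))

instance : CompleteSpace (EdgeFun ℓ) := inferInstanceAs (CompleteSpace C(Icc 0 ℓ, ℂ))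

/-- The restriction to `[0, ℓ]` of a function that is continuous there. -/
def EdgeFun.mk (u : ℝ → ℂ) (hu : ContinuousOn u (Icc 0 ℓ)) : EdgeFun ℓ :=
  (⟨(Icc 0 ℓ).domRestrict u, hu.domRestrict⟩ : C(Icc 0 ℓ, ℂ))

/-- The constant function `1`. -/
def EdgeFun.one : EdgeFun ℓ := EdgeFun.mk (fun _ => 1) continuousOn_const

/-- The continuous extension to `ℝ` of a continuous function on `[0, ℓ]`. -/
noncomputable def edgeExtend (hℓ : 0 ≤ ℓ) (u : EdgeFun ℓ) : ℝ → ℂ :=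
  IccExtend hℓ (show C(Icc 0 ℓ, ℂ) from u)

theorem continuous_edgeExtend (hℓ : 0 ≤ ℓ) (u : EdgeFun ℓ) : Continuous (edgeExtend hℓ u) :=
  (show C(Icc 0 ℓ, ℂ) from u).continuous.Icc_extend'

theorem continuous_uncurry_edgeExtend (hℓ : 0 ≤ ℓ) :
    Continuous fun z : EdgeFun ℓ × ℝ => edgeExtend hℓ z.1 z.2 := by
  have h : Continuous fun z : C(Icc 0 ℓ, ℂ) × ℝ => z.1 (projIcc 0 ℓ hℓ z.2) :=
    continuous_fst.eval (continuous_projIcc.comp continuous_snd)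
  exact h

theorem edgeExtend_mk (hℓ : 0 ≤ ℓ) {u : ℝ → ℂ} (hu : ContinuousOn u (Icc 0 ℓ)) {x : ℝ}
    (hx : x ∈ Icc 0 ℓ) : edgeExtend hℓ (EdgeFun.mk u hu) x = u x := IccExtend_of_mem _ _ hx

theorem edgeExtend_one (hℓ : 0 ≤ ℓ) (x : ℝ) : edgeExtend hℓ EdgeFun.one x = 1 := rfl

theorem edgeExtend_add (hℓ : 0 ≤ ℓ) (u w : EdgeFun ℓ) (x : ℝ) :
    edgeExtend hℓ (u + w) x = edgeExtend hℓ u x + edgeExtend hℓ w x := rfl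

theorem edgeExtend_sub (hℓ : 0 ≤ ℓ) (u w : EdgeFun ℓ) (x : ℝ) :
    edgeExtend hℓ (u - w) x = edgeExtend hℓ u x - edgeExtend hℓ w x := rfl

theorem edgeExtend_smul (hℓ : 0 ≤ ℓ) (c : ℂ) (u : EdgeFun ℓ) (x : ℝ) :
    edgeExtend hℓ (c • u) x = c * edgeExtend hℓ u x := rfl

theorem EdgeFun.ext_extend (hℓ : 0 ≤ ℓ) {u w : EdgeFun ℓ}
    (h : ∀ x ∈ Icc 0 ℓ, edgeExtend hℓ u x = edgeExtend hℓ w x) : u = w := by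
  refine ContinuousMap.ext (f := (show C(Icc 0 ℓ, ℂ) from u)) fun x => ?_
  have := h x x.2
  rwa [edgeExtend, edgeExtend, IccExtend_of_mem _ _ x.2, IccExtend_of_mem _ _ x.2] at this

theorem norm_edgeExtend_le (hℓ : 0 ≤ ℓ) (u : EdgeFun ℓ) (x : ℝ) :
    ‖edgeExtend hℓ u x‖ ≤ ‖u‖ := (show C(Icc 0 ℓ, ℂ) from u).norm_coe_le_norm _

theorem EdgeFun.norm_le (hℓ : 0 ≤ ℓ) {u : EdgeFun ℓ} {M : ℝ} (hM : 0 ≤ M)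
    (h : ∀ x ∈ Icc 0 ℓ, ‖edgeExtend hℓ u x‖ ≤ M) : ‖u‖ ≤ M := by
  refine (ContinuousMap.norm_le (show C(Icc 0 ℓ, ℂ) from u) hM).2 fun x => ?_
  have := h x x.2
  rwa [edgeExtend, IccExtend_of_mem _ _ x.2] at this

theorem IntervalIntegrable.mono_right {k : ℝ → ℂ} (hk : IntervalIntegrable k volume 0 ℓ) {x : ℝ}
    (hx : x ∈ Icc 0 ℓ) : IntervalIntegrable k volume 0 x :=
  hk.mono_set (by
    rw [uIcc_of_le hx.1, uIcc_of_le (hx.1.trans hx.2)]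
    exact Icc_subset_Icc_right hx.2)

/-- The bound `M` is needed only on `[0, x]`, not on the whole edge; this lets the iterated estimate
below keep its power of `x`. -/
theorem norm_integral_mul_le {k : ℝ → ℂ} (hk : IntervalIntegrable k volume 0 ℓ) {w : ℝ → ℂ}
    {x M : ℝ} (hx : x ∈ Icc 0 ℓ) (hM0 : 0 ≤ M) (hM : ∀ s ∈ Icc 0 x, ‖w s‖ ≤ M) :
    ‖∫ s in (0 : ℝ)..x, k s * w s‖ ≤ (∫ s in (0 : ℝ)..ℓ, ‖k s‖) * M := by
  have h1 := hk.mono_right hx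
  calc ‖∫ s in (0 : ℝ)..x, k s * w s‖ ≤ ∫ s in (0 : ℝ)..x, ‖k s‖ * M := by
        refine intervalIntegral.norm_integral_le_of_norm_le hx.1
          (Filter.Eventually.of_forall fun s hs => ?_) (h1.norm.mul_const _)
        rw [norm_mul]
        exact mul_le_mul_of_nonneg_left (hM s (Ioc_subset_Icc_self hs)) (norm_nonneg _)
    _ = (∫ s in (0 : ℝ)..x, ‖k s‖) * M := intervalIntegral.integral_mul_const _ _
    _ ≤ _ := by
        refine mul_le_mul_of_nonneg_right ?_ hM0
        exact intervalIntegral.integral_mono_interval le_rfl hx.1 hx.2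
          (Filter.Eventually.of_forall fun s => norm_nonneg _) hk.norm

theorem continuousOn_integral_mul_edgeExtend (hℓ : 0 ≤ ℓ) {k : ℝ → ℂ}
    (hk : IntervalIntegrable k volume 0 ℓ) (u : EdgeFun ℓ) :
    ContinuousOn (fun x => ∫ s in (0 : ℝ)..x, k s * edgeExtend hℓ u s) (Icc 0 ℓ) := by
  have h := intervalIntegral.continuousOn_primitive_interval'
    (hk.mul_continuousOn (continuous_edgeExtend hℓ u).continuousOn) left_mem_uIcc
  rwa [uIcc_of_le hℓ] at h

/-- The Volterra operator `u ↦ ∫₀ˣ k u`. -/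
noncomputable def volterra (hℓ : 0 ≤ ℓ) (k : ℝ → ℂ) (hk : IntervalIntegrable k volume 0 ℓ) :
    EdgeFun ℓ →L[ℂ] EdgeFun ℓ :=
  LinearMap.mkContinuous
    { toFun := fun u => EdgeFun.mk (fun x => ∫ s in (0 : ℝ)..x, k s * edgeExtend hℓ u s)
        (continuousOn_integral_mul_edgeExtend hℓ hk u)
      map_add' := fun u w => by
        refine EdgeFun.ext_extend hℓ fun x hx => ?_
        have hc : ∀ u : EdgeFun ℓ,
            IntervalIntegrable (fun s => k s * edgeExtend hℓ u s) volume 0 x := fun u =>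
          (hk.mono_right hx).mul_continuousOn (continuous_edgeExtend hℓ u).continuousOn
        simp only [edgeExtend_add, edgeExtend_mk hℓ _ hx, mul_add]
        exact intervalIntegral.integral_add (hc u) (hc w)
      map_smul' := fun c u => by
        refine EdgeFun.ext_extend hℓ fun x hx => ?_
        simp only [edgeExtend_smul, edgeExtend_mk hℓ _ hx, mul_left_comm _ c, RingHom.id_apply]
        exact intervalIntegral.integral_const_mul _ _ }
    (∫ s in (0 : ℝ)..ℓ, ‖k s‖) (fun u => by
      refine EdgeFun.norm_le hℓ (mul_nonneg
        (intervalIntegral.integral_nonneg hℓ fun _ _ => norm_nonneg _) (norm_nonneg _)) ?_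
      intro x hx
      simp only [LinearMap.coe_mk, AddHom.coe_mk, edgeExtend_mk hℓ _ hx]
      exact norm_integral_mul_le hk hx (norm_nonneg _) fun s _ => norm_edgeExtend_le hℓ u s)

theorem volterra_apply (hℓ : 0 ≤ ℓ) {k : ℝ → ℂ} (hk : IntervalIntegrable k volume 0 ℓ)
    (u : EdgeFun ℓ) {x : ℝ} (hx : x ∈ Icc 0 ℓ) :
    edgeExtend hℓ (volterra hℓ k hk u) x = ∫ s in (0 : ℝ)..x, k s * edgeExtend hℓ u s := by
  change edgeExtend hℓ (EdgeFun.mk _ (continuousOn_integral_mul_edgeExtend hℓ hk u)) x = _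
  rw [edgeExtend_mk hℓ _ hx]

/-- Makes the dependence on the spectral parameter affine, hence continuous in operator norm. -/
theorem volterra_sub_const (hℓ : 0 ≤ ℓ) {k : ℝ → ℂ} (hk : IntervalIntegrable k volume 0 ℓ) (c : ℂ) :
    volterra hℓ (fun s => k s - c) (hk.sub intervalIntegrable_const) =
      volterra hℓ k hk - c • volterra hℓ (fun _ => 1) intervalIntegrable_const := by
  refine ContinuousLinearMap.ext fun u => EdgeFun.ext_extend hℓ fun x hx => ?_
  rw [sub_apply, smul_apply, edgeExtend_sub,
    edgeExtend_smul, volterra_apply hℓ _ u hx, volterra_apply hℓ _ u hx, volterra_apply hℓ _ u hx]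
  simp only [sub_mul, one_mul]
  rw [← intervalIntegral.integral_const_mul]
  exact intervalIntegral.integral_sub
    ((hk.mono_right hx).mul_continuousOn (continuous_edgeExtend hℓ u).continuousOn)
    (((continuous_edgeExtend hℓ u).const_mul c).intervalIntegrable _ _)

/-- Integration from `0`. -/
noncomputable def integrate (hℓ : 0 ≤ ℓ) : EdgeFun ℓ →L[ℂ] EdgeFun ℓ :=
  volterra hℓ (fun _ => 1) intervalIntegrable_const

theorem integrate_apply (hℓ : 0 ≤ ℓ) (u : EdgeFun ℓ) {x : ℝ} (hx : x ∈ Icc 0 ℓ) :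
    edgeExtend hℓ (integrate hℓ u) x = ∫ s in (0 : ℝ)..x, edgeExtend hℓ u s := by
  rw [integrate, volterra_apply hℓ _ u hx]; simp

/-- Since `k` is merely integrable, `volterra` contributes only the factor `∫ ‖k‖`; the factorial
comes from `integrate`, which turns `sⁿ / n!` into `xⁿ⁺¹ / (n + 1)!`. -/
theorem norm_integrate_volterra_pow_apply_le (hℓ : 0 ≤ ℓ) {k : ℝ → ℂ}
    (hk : IntervalIntegrable k volume 0 ℓ) (n : ℕ) (u : EdgeFun ℓ) {x : ℝ} (hx : x ∈ Icc 0 ℓ) :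
    ‖edgeExtend hℓ (((integrate hℓ * volterra hℓ k hk) ^ n) u) x‖ ≤
      (∫ s in (0 : ℝ)..ℓ, ‖k s‖) ^ n * (x ^ n / n.factorial) * ‖u‖ := by
  set κ := ∫ s in (0 : ℝ)..ℓ, ‖k s‖ with hκ
  have hκ0 : 0 ≤ κ := intervalIntegral.integral_nonneg hℓ fun _ _ => norm_nonneg _
  induction n generalizing x hx with
  | zero => simpa using norm_edgeExtend_le hℓ u x
  | succ n ih =>
    rw [pow_succ', mul_apply_eq_comp, mul_apply_eq_comp, integrate_apply hℓ _ hx]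
    set w := ((integrate hℓ * volterra hℓ k hk) ^ n) u
    have hbound : ∀ s ∈ Ioc (0 : ℝ) x, ‖edgeExtend hℓ (volterra hℓ k hk w) s‖ ≤
        κ ^ (n + 1) / n.factorial * ‖u‖ * s ^ n := by
      intro s hs
      have hs' : s ∈ Icc 0 ℓ := ⟨hs.1.le, hs.2.trans hx.2⟩
      rw [volterra_apply hℓ _ _ hs']
      refine (norm_integral_mul_le hk hs' (M := κ ^ n * (s ^ n / n.factorial) * ‖u‖)
        (by have := hs.1; positivity) fun r hr => ?_).trans (le_of_eq ?_)
      · have hr' : r ∈ Icc 0 ℓ := ⟨hr.1, hr.2.trans hs'.2⟩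
        refine (ih hr').trans ?_
        have := hr.1
        have h2 := hr.2
        gcongr
      · rw [← hκ]; ring
    refine (intervalIntegral.norm_integral_le_of_norm_le hx.1
      (Filter.Eventually.of_forall hbound)
      ((continuous_const.mul (continuous_pow n)).intervalIntegrable _ _)).trans (le_of_eq ?_)
    rw [intervalIntegral.integral_const_mul]
    rw [integral_pow]
    rw [Nat.factorial_succ]
    have : (n.factorial : ℝ) ≠ 0 := by positivity
    push_cast
    field_simp
    simp

/-- `1 - ∫₀ˣ∫₀ˢ k` is invertible on `C[0, ℓ]`. -/
theorem isUnit_one_sub_integrate_volterra (hℓ : 0 ≤ ℓ) {k : ℝ → ℂ}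
    (hk : IntervalIntegrable k volume 0 ℓ) :
    IsUnit (1 - integrate hℓ * volterra hℓ k hk) := by
  set κ := ∫ s in (0 : ℝ)..ℓ, ‖k s‖ with hκ
  have hκ0 : 0 ≤ κ := intervalIntegral.integral_nonneg hℓ fun _ _ => norm_nonneg _
  set T := integrate hℓ * volterra hℓ k hk
  obtain ⟨n, hn⟩ := ((FloorSemiring.tendsto_pow_div_factorial_atTop (κ * ℓ)).eventually
    (gt_mem_nhds one_pos)).exists
  -- `T` itself need not be a contraction, but some power is, because `(κ ℓ)ⁿ / n!` tends to zero.
  have hT : ‖T ^ n‖ < 1 := by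
    refine lt_of_le_of_lt (ContinuousLinearMap.opNorm_le_bound _ (by positivity) fun u => ?_) hn
    refine EdgeFun.norm_le hℓ (by positivity) fun x hx => ?_
    refine (norm_integrate_volterra_pow_apply_le hℓ hk n u hx).trans ?_
    have h1 := hx.1
    have h2 := hx.2
    rw [mul_pow, mul_div_assoc]
    gcongr
  -- `1 - T ^ n` is the product of `1 - T` and a geometric sum commuting with it, so both factors
  -- are units.
  have h := isUnit_one_sub_of_norm_lt_one hT
  rw [← mul_neg_geom_sum] at h
  exact ((Commute.isUnit_mul_iff (Commute.sub_left (Commute.one_left _)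
    (Commute.sum_right _ _ _ fun i _ => Commute.self_pow T i))).1 h).1

end Volterra

/-! ### The initial value problem on an edge -/

section EdgeSolution

variable {ℓ : ℝ} (hℓ : 0 ≤ ℓ) (W : ℝ → ℂ) (hW : IntervalIntegrable W volume 0 ℓ)
  (h : EdgeFun ℓ)

/-- The integral operator `u ↦ u - ∫₀ˣ∫₀ˢ (W - c) u`. -/
noncomputable def edgeOp (c : ℂ) : EdgeFun ℓ →L[ℂ] EdgeFun ℓ :=
  1 - integrate hℓ * volterra hℓ (fun s => W s - c) (hW.sub intervalIntegrable_const)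

theorem isUnit_edgeOp (c : ℂ) : IsUnit (edgeOp hℓ W hW c) :=
  isUnit_one_sub_integrate_volterra hℓ _

/-- `edgeOp` is affine in `c`, and inversion in a Banach algebra is continuous at units. -/
theorem continuous_inverse_edgeOp : Continuous fun c => Ring.inverse (edgeOp hℓ W hW c) := by
  have hc : Continuous (edgeOp hℓ W hW) := by
    unfold edgeOp
    simp_rw [volterra_sub_const hℓ hW]
    fun_prop
  rw [continuous_iff_continuousAt]
  intro c
  obtain ⟨U, hU⟩ := isUnit_edgeOp hℓ W hW c
  have h1 := NormedRing.inverse_continuousAt U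
  rw [hU] at h1
  exact ContinuousAt.comp (f := edgeOp hℓ W hW) h1 hc.continuousAt

/-- The solution of `-u'' + W u = c u + m h`, `u(0) = a`, `u'(0) = b`, as a function of
`(a, b, m)`. -/
noncomputable def edgeSol (c : ℂ) : (ℂ × ℂ × ℂ) →ₗ[ℂ] EdgeFun ℓ :=
  (Ring.inverse (edgeOp hℓ W hW c)).toLinearMap ∘ₗ
    { toFun := fun y => y.1 • EdgeFun.one + y.2.1 • integrate hℓ EdgeFun.one -
        y.2.2 • integrate hℓ (integrate hℓ h)
      map_add' := fun y z => by
        simp only [Prod.fst_add, Prod.snd_add, add_smul]; abel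
      map_smul' := fun r y => by
        simp only [Prod.smul_fst, Prod.smul_snd, smul_sub, smul_add, smul_assoc, RingHom.id_apply] }

theorem edgeOp_edgeSol (c : ℂ) (y : ℂ × ℂ × ℂ) :
    edgeOp hℓ W hW c (edgeSol hℓ W hW h c y) =
      y.1 • EdgeFun.one + y.2.1 • integrate hℓ EdgeFun.one -
        y.2.2 • integrate hℓ (integrate hℓ h) := by
  change (edgeOp hℓ W hW c * Ring.inverse (edgeOp hℓ W hW c)) _ = _
  rw [Ring.mul_inverse_cancel _ (isUnit_edgeOp hℓ W hW c)]
  rfl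

theorem edgeSol_unique (c : ℂ) (y : ℂ × ℂ × ℂ) {u : EdgeFun ℓ}
    (hu : edgeOp hℓ W hW c u =
      y.1 • EdgeFun.one + y.2.1 • integrate hℓ EdgeFun.one -
        y.2.2 • integrate hℓ (integrate hℓ h)) :
    u = edgeSol hℓ W hW h c y := by
  rw [← edgeOp_edgeSol] at hu
  have hinj : ∀ w, w = (Ring.inverse (edgeOp hℓ W hW c) * edgeOp hℓ W hW c) w := fun w => by
    rw [Ring.inverse_mul_cancel _ (isUnit_edgeOp hℓ W hW c)]; rfl
  rw [hinj u, hinj (edgeSol hℓ W hW h c y), mul_apply_eq_comp, mul_apply_eq_comp, hu]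

theorem continuous_edgeSol (y : ℂ × ℂ × ℂ) : Continuous fun c => edgeSol hℓ W hW h c y :=
  (continuous_inverse_edgeOp hℓ W hW).clm_apply continuous_const

/-- The derivative of `edgeSol`. -/
noncomputable def edgeDer (c : ℂ) : (ℂ × ℂ × ℂ) →ₗ[ℂ] EdgeFun ℓ :=
  { toFun := fun y => y.2.1 • EdgeFun.one + volterra hℓ W hW (edgeSol hℓ W hW h c y) -
      c • integrate hℓ (edgeSol hℓ W hW h c y) - y.2.2 • integrate hℓ h
    map_add' := fun y z => by
      simp only [Prod.fst_add, Prod.snd_add, add_smul, map_add, smul_add]; abel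
    map_smul' := fun r y => by
      simp only [Prod.smul_fst, Prod.smul_snd, smul_sub, smul_add, smul_assoc, RingHom.id_apply,
        map_smul, smul_comm c r] }

theorem edgeDer_apply (c : ℂ) (y : ℂ × ℂ × ℂ) : edgeDer hℓ W hW h c y =
    y.2.1 • EdgeFun.one + volterra hℓ W hW (edgeSol hℓ W hW h c y) -
      c • integrate hℓ (edgeSol hℓ W hW h c y) - y.2.2 • integrate hℓ h := rfl

theorem continuous_edgeDer (y : ℂ × ℂ × ℂ) : Continuous fun c => edgeDer hℓ W hW h c y := by
  have := continuous_edgeSol hℓ W hW h y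
  simp only [edgeDer_apply]
  fun_prop

theorem edgeOp_apply (c : ℂ) (u : EdgeFun ℓ) : edgeOp hℓ W hW c u =
    u - integrate hℓ (volterra hℓ W hW u - c • integrate hℓ u) := by
  rw [edgeOp, volterra_sub_const hℓ hW]; rfl

/-- The integral equation with its outer integration pulled out; what remains under the integral is
`edgeDer`, so `edgeDer` is indeed the derivative of `edgeSol`. -/
theorem edgeSol_eq (c : ℂ) (y : ℂ × ℂ × ℂ) :
    edgeSol hℓ W hW h c y = y.1 • EdgeFun.one + integrate hℓ (edgeDer hℓ W hW h c y) := by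
  have h1 := edgeOp_edgeSol hℓ W hW h c y
  rw [edgeOp_apply, sub_eq_iff_eq_add] at h1
  rw [edgeDer_apply]
  nth_rw 1 [h1]
  simp only [map_sub, map_add, map_smul]
  abel

theorem isPrimitiveOn_edgeSol (c : ℂ) (y : ℂ × ℂ × ℂ) :
    IsPrimitiveOn ℓ (edgeExtend hℓ (edgeSol hℓ W hW h c y))
      (edgeExtend hℓ (edgeDer hℓ W hW h c y)) := by
  have key : ∀ x (hx : x ∈ Icc 0 ℓ), edgeExtend hℓ (edgeSol hℓ W hW h c y) x =
      y.1 + ∫ s in (0 : ℝ)..x, edgeExtend hℓ (edgeDer hℓ W hW h c y) s := by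
    intro x hx
    rw [edgeSol_eq, edgeExtend_add, integrate_apply hℓ _ hx, edgeExtend_smul, edgeExtend_one,
      mul_one]
  refine ⟨(continuous_edgeExtend hℓ _).intervalIntegrable _ _, fun x hx => ?_⟩
  rw [key x hx, key 0 ⟨le_rfl, hℓ⟩]; simp

/-- The second derivative of `edgeSol`. -/
noncomputable def edgeDer2 (c : ℂ) (y : ℂ × ℂ × ℂ) (x : ℝ) : ℂ :=
  W x * edgeExtend hℓ (edgeSol hℓ W hW h c y) x - c * edgeExtend hℓ (edgeSol hℓ W hW h c y) x -
    y.2.2 * edgeExtend hℓ h x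

theorem edgeExtend_edgeDer (c : ℂ) (y : ℂ × ℂ × ℂ) {x : ℝ} (hx : x ∈ Icc 0 ℓ) :
    edgeExtend hℓ (edgeDer hℓ W hW h c y) x =
      y.2.1 + ∫ s in (0 : ℝ)..x, edgeDer2 hℓ W hW h c y s := by
  unfold edgeDer2
  have hi := (hW.mono_right hx).mul_continuousOn
    (continuous_edgeExtend hℓ (edgeSol hℓ W hW h c y)).continuousOn
  have hi2 := ((continuous_edgeExtend hℓ (edgeSol hℓ W hW h c y)).const_mul c).intervalIntegrable
    (μ := volume) 0 x
  have hi3 := ((continuous_edgeExtend hℓ h).const_mul y.2.2).intervalIntegrable (μ := volume) 0 x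
  rw [intervalIntegral.integral_sub (hi.sub hi2) hi3, intervalIntegral.integral_sub hi hi2,
    intervalIntegral.integral_const_mul, intervalIntegral.integral_const_mul,
    edgeDer_apply]
  simp only [edgeExtend_add, edgeExtend_sub, edgeExtend_smul, integrate_apply hℓ _ hx,
    volterra_apply hℓ _ _ hx, edgeExtend_one, mul_one]
  ring

theorem isPrimitiveOn_edgeDer (c : ℂ) (y : ℂ × ℂ × ℂ) :
    IsPrimitiveOn ℓ (edgeExtend hℓ (edgeDer hℓ W hW h c y)) (edgeDer2 hℓ W hW h c y) := by
  refine ⟨?_, fun x hx => ?_⟩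
  · exact ((hW.mul_continuousOn (continuous_edgeExtend hℓ _).continuousOn).sub
      (((continuous_edgeExtend hℓ _).const_mul c).intervalIntegrable _ _)).sub
      (((continuous_edgeExtend hℓ h).const_mul y.2.2).intervalIntegrable _ _)
  · rw [edgeExtend_edgeDer hℓ W hW h c y hx, edgeExtend_edgeDer hℓ W hW h c y ⟨le_rfl, hℓ⟩]
    simp

theorem edgeSol_zero (c : ℂ) (y : ℂ × ℂ × ℂ) : edgeExtend hℓ (edgeSol hℓ W hW h c y) 0 = y.1 := by
  rw [edgeSol_eq, edgeExtend_add, integrate_apply hℓ _ ⟨le_rfl, hℓ⟩, edgeExtend_smul,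
    edgeExtend_one]
  simp

/-- Uniqueness for the homogeneous equation. -/
theorem eq_edgeSol_of_isPrimitiveOn (c : ℂ) {u p q : ℝ → ℂ} (hu : IsPrimitiveOn ℓ u p)
    (hp : IsPrimitiveOn ℓ p q)
    (hq : ∀ᵐ x ∂(volume.restrict (Ioo 0 ℓ)), q x = W x * u x - c * u x) :
    ∀ x ∈ Icc 0 ℓ, u x = edgeExtend hℓ (edgeSol hℓ W hW h c (u 0, p 0, 0)) x ∧
      p x = edgeExtend hℓ (edgeDer hℓ W hW h c (u 0, p 0, 0)) x := by
  set u' : EdgeFun ℓ := EdgeFun.mk u (hu.continuousOn hℓ) with hu'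
  set p' : EdgeFun ℓ := EdgeFun.mk p (hp.continuousOn hℓ) with hp'
  have eu : ∀ x ∈ Icc 0 ℓ, edgeExtend hℓ u' x = u x := fun x hx => edgeExtend_mk hℓ _ hx
  have ep : ∀ x ∈ Icc 0 ℓ, edgeExtend hℓ p' x = p x := fun x hx => edgeExtend_mk hℓ _ hx
  have h1 : u' = u 0 • EdgeFun.one + integrate hℓ p' := by
    refine EdgeFun.ext_extend hℓ fun x hx => ?_
    rw [eu x hx, edgeExtend_add, edgeExtend_smul, edgeExtend_one, integrate_apply hℓ _ hx,
      hu.2 x hx, mul_one]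
    congr 1
    refine intervalIntegral.integral_congr fun s hs => ?_
    rw [uIcc_of_le hx.1] at hs
    exact (ep s ⟨hs.1, hs.2.trans hx.2⟩).symm
  have h2 : p' = p 0 • EdgeFun.one + (volterra hℓ W hW u' - c • integrate hℓ u') := by
    refine EdgeFun.ext_extend hℓ fun x hx => ?_
    rw [ep x hx, edgeExtend_add, edgeExtend_smul, edgeExtend_one, edgeExtend_sub, edgeExtend_smul,
      integrate_apply hℓ _ hx, volterra_apply hℓ _ _ hx, hp.2 x hx, mul_one,
      ← intervalIntegral.integral_const_mul, ← intervalIntegral.integral_sub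
      ((hW.mono_right hx).mul_continuousOn (continuous_edgeExtend hℓ u').continuousOn)
      (((continuous_edgeExtend hℓ u').const_mul c).intervalIntegrable _ _)]
    congr 1
    refine intervalIntegral.integral_congr_ae ?_
    rw [Measure.restrict_congr_set Ioo_ae_eq_Ioc, ae_restrict_iff' measurableSet_Ioc] at hq
    filter_upwards [hq] with s hs hsx
    rw [uIoc_of_le hx.1] at hsx
    have hs' : s ∈ Ioc 0 ℓ := ⟨hsx.1, hsx.2.trans hx.2⟩
    rw [hs hs', eu s (Ioc_subset_Icc_self hs')]
  -- Substituting `h2` into `h1` gives the integral equation with `m = 0`, whose solution is unique.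
  have h3 : u' = edgeSol hℓ W hW h c (u 0, p 0, 0) := by
    apply edgeSol_unique
    rw [edgeOp_apply]
    nth_rw 1 [h1]
    rw [h2]
    simp only [map_add, map_smul, zero_smul, sub_zero]
    abel
  have h4 : p' = edgeDer hℓ W hW h c (u 0, p 0, 0) := by
    rw [edgeDer_apply, ← h3, h2]
    simp only [zero_smul, sub_zero]
    abel
  intro x hx
  rw [← h3, ← h4, eu x hx, ep x hx]
  exact ⟨rfl, rfl⟩

end EdgeSolution

/-! ### Abstract bordered systems: existence and derivative of a branch -/

section Bordered

open Filter Topology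

variable {Y Z : Type*} [NormedAddCommGroup Y] [NormedSpace ℂ Y]
  [NormedAddCommGroup Z] [NormedSpace ℂ Z]

/-- Data of a two-parameter family of bordered linear systems `J (lam, t)` obtained from a family of
self-adjoint eigenvalue problems: `m` is the bordering unknown, `ip` the inner product of solutions
and `q` the boundary functional entering Green's identity. -/
structure BorderedFamily (J : ℝ × ℝ → Y →L[ℂ] Z × ℂ) (m : Y →L[ℂ] ℂ)
    (ip : (ℝ × Y) → (ℝ × Y) → ℂ) (q : ℝ × Y → ℂ) (N : ℝ) : Prop where
  continuous_J : Continuous J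
  continuous_ip : Continuous fun z : (ℝ × Y) × (ℝ × Y) => ip z.1 z.2
  continuous_q : Continuous q
  pos : 0 < N
  green : ∀ (p p' : ℝ × ℝ) (y y' : Y), J p y = (0, (N : ℂ)) → J p' y' = (0, (N : ℂ)) →
    ((p.2 : ℂ) - p'.2) * (starRingEnd ℂ (q (p'.1, y')) * q (p.1, y)) =
      ((p.1 : ℂ) - p'.1) * ip (p'.1, y') (p.1, y) + (m y - starRingEnd ℂ (m y')) * N

namespace BorderedFamily

variable {J : ℝ × ℝ → Y →L[ℂ] Z × ℂ} {m : Y →L[ℂ] ℂ} {ip : (ℝ × Y) → (ℝ × Y) → ℂ}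
  {q : ℝ × Y → ℂ} {N : ℝ}

/-- The parameters at which the system is uniquely solvable. -/
def regular (J : ℝ × ℝ → Y →L[ℂ] Z × ℂ) : Set (ℝ × ℝ) :=
  J ⁻¹' range ((↑) : (Y ≃L[ℂ] Z × ℂ) → Y →L[ℂ] Z × ℂ)

/-- The solution of `J p y = (0, N)`. -/
noncomputable def sol (J : ℝ × ℝ → Y →L[ℂ] Z × ℂ) (N : ℝ) (p : ℝ × ℝ) : Y :=
  (J p).inverse (0, (N : ℂ))

theorem isOpen_regular [CompleteSpace Y] (H : BorderedFamily J m ip q N) : IsOpen (regular J) :=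
  (ContinuousLinearEquiv.isOpen).preimage H.continuous_J

theorem J_sol {p : ℝ × ℝ} (hp : p ∈ regular J) : J p (sol J N p) = (0, (N : ℂ)) := by
  obtain ⟨e, he⟩ := hp
  rw [sol, ← he, ContinuousLinearMap.inverse_equiv]
  exact e.apply_symm_apply _

theorem injective_of_regular {p : ℝ × ℝ} (hp : p ∈ regular J) : Function.Injective (J p) := by
  obtain ⟨e, he⟩ := hp
  rw [← he]
  exact e.injective

theorem continuousAt_sol [CompleteSpace Y] (H : BorderedFamily J m ip q N)
    {p : ℝ × ℝ} (hp : p ∈ regular J) :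
    ContinuousAt (sol J N) p := by
  obtain ⟨e, he⟩ := hp
  have h1 : ContinuousAt ContinuousLinearMap.inverse (J p) := by
    rw [← he]
    exact (contDiffAt_map_inverse (n := 0) e).continuousAt
  exact (ContinuousAt.comp (f := J) h1 H.continuous_J.continuousAt).clm_apply continuousAt_const

/-- Green's identity of the solution with itself leaves `(m - conj m) N = 0`. Hence `m = 0` is one
real equation, accessible to the intermediate value theorem. -/
theorem im_eq_zero (H : BorderedFamily J m ip q N) {p : ℝ × ℝ} (hp : p ∈ regular J) :
    (m (sol J N p)).im = 0 := by
  have h := H.green p p _ _ (J_sol hp) (J_sol hp)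
  have hN : (N : ℂ) ≠ 0 := by exact_mod_cast H.pos.ne'
  simp only [sub_self, zero_mul, zero_add] at h
  have h' := (mul_eq_zero.1 h.symm).resolve_right hN
  exact Complex.conj_eq_iff_im.1 (sub_eq_zero.1 h').symm

/-- For equal `t` the vertex term of Green's identity drops out, so the inner product of two
solutions controls how `m` varies with `lam`. -/
theorem re_sub_re (H : BorderedFamily J m ip q N) {a b t : ℝ} (ha : (a, t) ∈ regular J)
    (hb : (b, t) ∈ regular J) :
    ((m (sol J N (a, t))).re - (m (sol J N (b, t))).re) * N =
      (b - a) * (ip (b, sol J N (b, t)) (a, sol J N (a, t))).re := by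
  have h := congrArg Complex.re (H.green (a, t) (b, t) _ _ (J_sol ha) (J_sol hb))
  simp only [sub_self, zero_mul, Complex.zero_re, Complex.add_re, ← Complex.ofReal_sub,
    Complex.re_ofReal_mul, Complex.re_mul_ofReal, Complex.sub_re, Complex.conj_re] at h
  linarith

theorem eventually_rect {p₀ : ℝ × ℝ} {P : (ℝ × ℝ) × (ℝ × ℝ) → Prop}
    (h : ∀ᶠ z in 𝓝 (p₀, p₀), P z) : ∃ δ > 0, ∀ a b t s : ℝ, |a - p₀.1| ≤ δ → |b - p₀.1| ≤ δ →
      |t - p₀.2| ≤ δ → |s - p₀.2| ≤ δ → P ((a, t), (b, s)) := by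
  obtain ⟨δ, hδ, h⟩ := Metric.nhds_basis_closedBall.eventually_iff.1 h
  refine ⟨δ, hδ, fun a b t s h1 h2 h3 h4 => h ?_⟩
  simp only [Metric.mem_closedBall, Prod.dist_eq, Real.dist_eq, max_le_iff]
  exact ⟨⟨h1, h3⟩, h2, h4⟩

/-- At `p₀` the inner product is `N`, so nearby its real part exceeds `N / 2`. By `re_sub_re`, `m`
then decreases in `lam` at a rate greater than `1 / 2`, uniformly in `t`; hence the factor `2`. -/
theorem exists_rect [CompleteSpace Y] (H : BorderedFamily J m ip q N)
    {p₀ : ℝ × ℝ} (hp₀ : p₀ ∈ regular J)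
    (hip : ip (p₀.1, sol J N p₀) (p₀.1, sol J N p₀) = N) :
    ∃ δ > 0, (∀ a t : ℝ, |a - p₀.1| ≤ δ → |t - p₀.2| ≤ δ → (a, t) ∈ regular J) ∧
      ∀ a b t : ℝ, |a - p₀.1| ≤ δ → |b - p₀.1| ≤ δ → |t - p₀.2| ≤ δ →
        |a - b| ≤ 2 * |(m (sol J N (a, t))).re - (m (sol J N (b, t))).re| ∧
        (a < b → (m (sol J N (b, t))).re < (m (sol J N (a, t))).re) := by
  have hs := H.continuousAt_sol hp₀
  have h1 : ContinuousAt (fun z : (ℝ × ℝ) × (ℝ × ℝ) =>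
      (ip (z.2.1, sol J N z.2) (z.1.1, sol J N z.1)).re) (p₀, p₀) := by
    refine Complex.continuous_re.continuousAt.comp ?_
    refine ContinuousAt.comp (g := fun z : (ℝ × Y) × (ℝ × Y) => ip z.1 z.2)
      (f := fun z : (ℝ × ℝ) × (ℝ × ℝ) => ((z.2.1, sol J N z.2), (z.1.1, sol J N z.1)))
      H.continuous_ip.continuousAt ?_
    have hs1 : ContinuousAt (fun z : (ℝ × ℝ) × (ℝ × ℝ) => sol J N z.1) (p₀, p₀) :=
      ContinuousAt.comp (f := Prod.fst) (x := (p₀, p₀)) hs continuousAt_fst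
    have hs2 : ContinuousAt (fun z : (ℝ × ℝ) × (ℝ × ℝ) => sol J N z.2) (p₀, p₀) :=
      ContinuousAt.comp (f := Prod.snd) (x := (p₀, p₀)) hs continuousAt_snd
    exact ((continuousAt_snd.fst).prodMk hs2).prodMk ((continuousAt_fst.fst).prodMk hs1)
  have hN := H.pos
  have h2 : ∀ᶠ z : (ℝ × ℝ) × (ℝ × ℝ) in 𝓝 (p₀, p₀),
      N / 2 < (ip (z.2.1, sol J N z.2) (z.1.1, sol J N z.1)).re := by
    refine h1.eventually (lt_mem_nhds ?_)
    simp only [hip, Complex.ofReal_re]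
    linarith
  have h3 : ∀ᶠ z : (ℝ × ℝ) × (ℝ × ℝ) in 𝓝 (p₀, p₀), z.1 ∈ regular J :=
    continuousAt_fst.eventually (H.isOpen_regular.mem_nhds hp₀)
  obtain ⟨δ, hδ, h⟩ := eventually_rect (h2.and h3)
  have hr : ∀ a t : ℝ, |a - p₀.1| ≤ δ → |t - p₀.2| ≤ δ → (a, t) ∈ regular J :=
    fun a t ha ht => (h a a t t ha ha ht ht).2
  refine ⟨δ, hδ, hr, fun a b t ha hb ht => ?_⟩
  have e := H.re_sub_re (hr a t ha ht) (hr b t hb ht)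
  have hD := (h a b t t ha hb ht ht).1
  simp only at hD
  set D := (ip (b, sol J N (b, t)) (a, sol J N (a, t))).re
  constructor
  · have e' := congrArg abs e
    rw [abs_mul, abs_mul, abs_of_pos hN, abs_of_pos (by linarith : 0 < D), abs_sub_comm b a] at e'
    have : |a - b| * (N / 2) ≤ |a - b| * D := mul_le_mul_of_nonneg_left hD.le (abs_nonneg _)
    rw [← e'] at this
    refine le_of_mul_le_mul_right ?_ hN
    linarith
  · intro hab
    have : 0 < (b - a) * D := mul_pos (by linarith) (by linarith)
    rw [← e] at this
    have := pos_of_mul_pos_left this hN.le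
    linarith

theorem continuousAt_re [CompleteSpace Y] (H : BorderedFamily J m ip q N)
    {a t : ℝ} (hp : (a, t) ∈ regular J) :
    ContinuousAt (fun p => (m (sol J N p)).re) (a, t) :=
  Complex.continuous_re.continuousAt.comp
    (m.continuous.continuousAt.comp (H.continuousAt_sol hp))

/-- Existence of a branch of parameters at which the original problem is solvable. -/
theorem exists_branch [CompleteSpace Y] (H : BorderedFamily J m ip q N)
    {a₀ t₀ : ℝ} (hp₀ : (a₀, t₀) ∈ regular J)
    (hip : ip (a₀, sol J N (a₀, t₀)) (a₀, sol J N (a₀, t₀)) = N)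
    (hm : m (sol J N (a₀, t₀)) = 0) :
    ∃ (U : Set ℝ) (lam : ℝ → ℝ), IsOpen U ∧ t₀ ∈ U ∧ lam t₀ = a₀ ∧ ContinuousOn lam U ∧
      ∀ t ∈ U, (lam t, t) ∈ regular J ∧ m (sol J N (lam t, t)) = 0 := by
  obtain ⟨δ, hδ, hr, hmono⟩ := H.exists_rect hp₀ hip
  dsimp only at hr hmono
  set g : ℝ → ℝ → ℝ := fun a t => (m (sol J N (a, t))).re with hg
  have hδ1 : |a₀ + δ - a₀| ≤ δ := by rw [add_sub_cancel_left, abs_of_pos hδ]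
  have hδ2 : |a₀ - δ - a₀| ≤ δ := by rw [sub_sub_cancel_left, abs_neg, abs_of_pos hδ]
  have h00 : |a₀ - a₀| ≤ δ := by simpa using hδ.le
  have h00' : |t₀ - t₀| ≤ δ := by simpa using hδ.le
  have hg0 : g a₀ t₀ = 0 := by simp [hg, hm]
  have hct : ∀ a t, |a - a₀| ≤ δ → |t - t₀| ≤ δ → ContinuousAt (g a) t := fun a t ha ht =>
    ContinuousAt.comp (f := fun t => (a, t)) (H.continuousAt_re (hr a t ha ht))
      (continuousAt_const.prodMk continuousAt_id)
  have hca : ∀ a t, |a - a₀| ≤ δ → |t - t₀| ≤ δ → ContinuousAt (fun a => g a t) a :=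
    fun a t ha ht => ContinuousAt.comp (f := fun a => (a, t)) (H.continuousAt_re (hr a t ha ht))
      (continuousAt_id.prodMk continuousAt_const)
  have hp : g (a₀ + δ) t₀ < 0 := by
    rw [← hg0]; exact (hmono _ _ t₀ h00 hδ1 h00').2 (by linarith)
  have hn : 0 < g (a₀ - δ) t₀ := by
    rw [← hg0]; exact (hmono _ _ t₀ hδ2 h00 h00').2 (by linarith)
  -- The signs at `a₀ ± δ` persist for `t` near `t₀`, so a root in between persists too.
  have hev : ∀ᶠ t in 𝓝 t₀, |t - t₀| < δ ∧ g (a₀ + δ) t < 0 ∧ 0 < g (a₀ - δ) t := by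
    refine Filter.Eventually.and ?_ (((hct _ _ hδ1 h00').eventually (gt_mem_nhds hp)).and
      ((hct _ _ hδ2 h00').eventually (lt_mem_nhds hn)))
    exact Metric.ball_mem_nhds t₀ hδ
  obtain ⟨U, hU, hUo, htU⟩ := eventually_nhds_iff.1 hev
  have hex : ∀ t ∈ U, ∃ a, |a - a₀| ≤ δ ∧ g a t = 0 := by
    intro t ht
    obtain ⟨h1, h2, h3⟩ := hU t ht
    have hc : ContinuousOn (fun a => g a t) (Icc (a₀ - δ) (a₀ + δ)) := fun a ha =>
      (hca a t (abs_le.2 ⟨by linarith [ha.1], by linarith [ha.2]⟩) h1.le).continuousWithinAt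
    obtain ⟨a, ha, h0⟩ := intermediate_value_Icc' (by linarith) hc ⟨h2.le, h3.le⟩
    exact ⟨a, abs_le.2 ⟨by linarith [ha.1], by linarith [ha.2]⟩, h0⟩
  choose! lam hlam hlam0 using hex
  refine ⟨U, lam, hUo, htU, ?_, fun t ht => ContinuousAt.continuousWithinAt ?_, fun t ht =>
    ⟨hr _ _ (hlam t ht) (hU t ht).1.le, ?_⟩⟩
  · have h := (hmono (lam t₀) a₀ t₀ (hlam t₀ htU) h00 h00').1
    change _ ≤ 2 * |g (lam t₀) t₀ - g a₀ t₀| at h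
    rw [hlam0 t₀ htU, hg0, sub_self, abs_zero, mul_zero] at h
    exact sub_eq_zero.1 (abs_eq_zero.1 (le_antisymm h (abs_nonneg _)))
  -- Continuity of the root: `|lam s - lam t| ≤ 2 |g (lam t) s|`, and the right side tends to `2 |g
  -- (lam t) t| = 0` as `s → t`.
  · have hc := hct (lam t) t (hlam t ht) (hU t ht).1.le
    rw [ContinuousAt, hlam0 t ht] at hc
    have hc' : Tendsto (fun s => 2 * |g (lam t) s|) (𝓝 t) (𝓝 0) := by
      simpa using (hc.abs).const_mul 2
    rw [ContinuousAt, tendsto_iff_dist_tendsto_zero]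
    refine squeeze_zero' (Eventually.of_forall fun _ => dist_nonneg) ?_ hc'
    filter_upwards [hUo.mem_nhds ht] with s hs
    have h := (hmono (lam s) (lam t) s (hlam s hs) (hlam t ht) (hU s hs).1.le).1
    change _ ≤ 2 * |g (lam s) s - g (lam t) s| at h
    rwa [hlam0 s hs, zero_sub, abs_neg] at h
  · exact Complex.ext (hlam0 t ht) (H.im_eq_zero (hr _ _ (hlam t ht) (hU t ht).1.le))

/-- The derivative of a branch of parameters at which the original problem is solvable. -/
theorem hasDerivAt_branch [CompleteSpace Y] (H : BorderedFamily J m ip q N)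
    {t₀ : ℝ} {lam : ℝ → ℝ}
    (hp₀ : (lam t₀, t₀) ∈ regular J)
    (hip : ip (lam t₀, sol J N (lam t₀, t₀)) (lam t₀, sol J N (lam t₀, t₀)) = N)
    (hc : ContinuousAt lam t₀)
    (hker : ∀ᶠ t in 𝓝 t₀, ∃ y, y ≠ 0 ∧ (J (lam t, t) y).1 = 0 ∧ m y = 0) :
    HasDerivAt lam (‖q (lam t₀, sol J N (lam t₀, t₀))‖ ^ 2 / N) t₀ := by
  set y₀ := sol J N (lam t₀, t₀) with hy₀
  have hN : (N : ℂ) ≠ 0 := by exact_mod_cast H.pos.ne'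
  have hcp : ContinuousAt (fun t => (lam t, t)) t₀ := hc.prodMk continuousAt_id
  have hm0 : ∀ᶠ t in 𝓝 t₀, (lam t, t) ∈ regular J ∧ m (sol J N (lam t, t)) = 0 := by
    filter_upwards [hker, hcp.eventually (H.isOpen_regular.mem_nhds hp₀)] with t ⟨y, hy, h1, h2⟩ hr
    refine ⟨hr, ?_⟩
    -- A null vector of the vertex conditions with `m = 0` cannot have zero second component, by
    -- injectivity; rescaled, it is therefore the solution, whose `m` vanishes.
    have hc0 : (J (lam t, t) y).2 ≠ 0 := fun h0 => hy (injective_of_regular hr (by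
      rw [map_zero]; exact Prod.ext h1 h0))
    have : sol J N (lam t, t) = (N / (J (lam t, t) y).2) • y := by
      refine injective_of_regular hr ?_
      rw [J_sol hr, map_smul]
      refine Prod.ext ?_ ?_
      · simp [h1]
      · simp [div_mul_cancel₀ _ hc0]
    rw [this, map_smul, h2, smul_zero]
  have hsol : ContinuousAt (fun t => (lam t, sol J N (lam t, t))) t₀ :=
    hc.prodMk (ContinuousAt.comp (f := fun t => (lam t, t)) (H.continuousAt_sol hp₀) hcp)
  set A : ℝ → ℝ := fun t => (starRingEnd ℂ (q (lam t₀, y₀)) * q (lam t, sol J N (lam t, t))).re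
    with hA
  set B : ℝ → ℝ := fun t => (ip (lam t₀, y₀) (lam t, sol J N (lam t, t))).re with hB
  have hAc : Tendsto A (𝓝 t₀) (𝓝 (‖q (lam t₀, y₀)‖ ^ 2)) := by
    have h : ContinuousAt A t₀ := Complex.continuous_re.continuousAt.comp
      (continuousAt_const.mul (ContinuousAt.comp (g := q) H.continuous_q.continuousAt hsol))
    have h0 : A t₀ = ‖q (lam t₀, y₀)‖ ^ 2 := by
      simp only [hA]
      rw [← hy₀, ← Complex.normSq_eq_conj_mul_self, Complex.ofReal_re, Complex.normSq_eq_norm_sq]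
    rw [← h0]; exact h
  have hBc : Tendsto B (𝓝 t₀) (𝓝 N) := by
    have h : ContinuousAt B t₀ := Complex.continuous_re.continuousAt.comp
      (ContinuousAt.comp (g := fun z : (ℝ × Y) × (ℝ × Y) => ip z.1 z.2)
        (f := fun t => ((lam t₀, y₀), (lam t, sol J N (lam t, t))))
        H.continuous_ip.continuousAt (continuousAt_const.prodMk hsol))
    have h0 : B t₀ = N := by
      simp only [hB]
      rw [← hy₀, hip, Complex.ofReal_re]
    rw [ContinuousAt, h0] at h
    exact h
  rw [hasDerivAt_iff_tendsto_slope]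
  refine ((hAc.div hBc H.pos.ne').mono_left nhdsWithin_le_nhds).congr' ?_
  filter_upwards [nhdsWithin_le_nhds hm0, self_mem_nhdsWithin,
    nhdsWithin_le_nhds (hBc.eventually (lt_mem_nhds H.pos))] with t ht htne hBt
  have hne : t - t₀ ≠ 0 := sub_ne_zero.2 htne
  -- Both values of `m` are zero, so Green's identity reads `(t - t₀) A = (lam t - lam t₀) B`: the
  -- slope is `A / B`.
  have h := congrArg Complex.re
    (H.green (lam t, t) (lam t₀, t₀) _ _ (J_sol ht.1) (J_sol hp₀))
  have hm00 : m (sol J N (lam t₀, t₀)) = 0 := hm0.self_of_nhds.2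
  simp only [ht.2, hm00, map_zero, sub_self, zero_mul, add_zero, ← Complex.ofReal_sub,
    Complex.re_ofReal_mul] at h
  change (t - t₀) * A t = (lam t - lam t₀) * B t at h
  rw [slope_def_field, Pi.div_apply, div_eq_div_iff hBt.ne' hne]
  linarith

end BorderedFamily

end Bordered

/-! ### Vertex conditions and Green's identity at the vertices -/

open scoped ComplexOrder in
/-- The kernel of `(A B)` is isotropic for the symplectic form of Green's identity. -/
theorem SelfAdjointCondition.green {ι : Type*} [Fintype ι] (c : SelfAdjointCondition ι)
    {F F' G G' : ι → ℂ} (hF : c.A *ᵥ F + c.B *ᵥ F' = 0) (hG : c.A *ᵥ G + c.B *ᵥ G' = 0) :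
    ∑ b, (starRingEnd ℂ (G b) * F' b - starRingEnd ℂ (G' b) * F b) = 0 := by
  classical
  set M : (ι → ℂ) × (ι → ℂ) →ₗ[ℂ] (ι → ℂ) := c.A.mulVecLin.coprod c.B.mulVecLin with hM
  -- The map `x ↦ (B* x, -A* x)` parametrises the kernel of `(A B)`: it lands there because `A B*`
  -- is self-adjoint, and it fills it because maximal rank gives both spaces dimension `card ι`.
  set T : (ι → ℂ) →ₗ[ℂ] (ι → ℂ) × (ι → ℂ) := (c.Bᴴ.mulVecLin).prod (-c.Aᴴ.mulVecLin) with hT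
  have hAB : c.B * c.Aᴴ = c.A * c.Bᴴ := by
    have h := c.selfAdjoint.eq
    rwa [Matrix.conjTranspose_mul, Matrix.conjTranspose_conjTranspose] at h
  have hMT : LinearMap.range T ≤ LinearMap.ker M := by
    rintro _ ⟨x, rfl⟩
    rw [LinearMap.mem_ker]
    simp [hM, hT, Matrix.mulVec_neg, hAB]
  have hrank : Module.finrank ℂ (LinearMap.range M) = Fintype.card ι := by
    have h : LinearMap.range M = LinearMap.range (Matrix.fromCols c.A c.B).mulVecLin := by
      ext z
      constructor
      · rintro ⟨⟨x, y⟩, rfl⟩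
        exact ⟨Sum.elim x y, by simp [hM, Matrix.fromCols_mulVec]⟩
      · rintro ⟨x, rfl⟩
        exact ⟨(x ∘ Sum.inl, x ∘ Sum.inr), by simp [hM, Matrix.fromCols_mulVec]⟩
    rw [h]; exact c.rank_eq
  have hker : Module.finrank ℂ (LinearMap.ker M) = Fintype.card ι := by
    have h := M.finrank_range_add_finrank_ker
    rw [hrank, Module.finrank_prod, Module.finrank_fintype_fun_eq_card] at h
    omega
  have hTinj : LinearMap.ker T = ⊥ := by
    have hN : LinearMap.ker (Matrix.fromCols c.A c.B)ᴴ.mulVecLin = ⊥ := by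
      have h := (Matrix.fromCols c.A c.B)ᴴ.mulVecLin.finrank_range_add_finrank_ker
      have h2 : Module.finrank ℂ (LinearMap.range (Matrix.fromCols c.A c.B)ᴴ.mulVecLin) =
          Fintype.card ι := (Matrix.rank_conjTranspose _).trans c.rank_eq
      rw [h2, Module.finrank_fintype_fun_eq_card] at h
      exact Submodule.finrank_eq_zero.1 (by omega)
    rw [eq_bot_iff]
    intro x hx
    have hx' : c.Bᴴ *ᵥ x = 0 ∧ c.Aᴴ *ᵥ x = 0 := by
      rw [LinearMap.mem_ker] at hx
      simpa [hT] using hx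
    rw [← hN, LinearMap.mem_ker, Matrix.mulVecLin_apply,
      Matrix.conjTranspose_fromCols_eq_fromRows_conjTranspose, Matrix.fromRows_mulVec, hx'.1, hx'.2]
    ext i; cases i <;> rfl
  have heq : LinearMap.range T = LinearMap.ker M := by
    refine Submodule.eq_of_le_of_finrank_eq hMT ?_
    rw [hker, LinearMap.finrank_range_of_inj (LinearMap.ker_eq_bot.1 hTinj),
      Module.finrank_fintype_fun_eq_card]
  have hex : ∀ F F' : ι → ℂ, c.A *ᵥ F + c.B *ᵥ F' = 0 → ∃ x, c.Bᴴ *ᵥ x = F ∧ -(c.Aᴴ *ᵥ x) = F' := by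
    intro F F' h
    have : (F, F') ∈ LinearMap.range T := by
      rw [heq, LinearMap.mem_ker]; simpa [hM] using h
    obtain ⟨x, hx⟩ := this
    exact ⟨x, congrArg Prod.fst hx, congrArg Prod.snd hx⟩
  obtain ⟨x, rfl, rfl⟩ := hex F F' hF
  obtain ⟨y, rfl, rfl⟩ := hex G G' hG
  have e : ∑ b, (starRingEnd ℂ ((c.Bᴴ *ᵥ y) b) * (-(c.Aᴴ *ᵥ x)) b -
      starRingEnd ℂ ((-(c.Aᴴ *ᵥ y)) b) * (c.Bᴴ *ᵥ x) b) =
      star (c.Bᴴ *ᵥ y) ⬝ᵥ (-(c.Aᴴ *ᵥ x)) - star (-(c.Aᴴ *ᵥ y)) ⬝ᵥ (c.Bᴴ *ᵥ x) := by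
    rw [Finset.sum_sub_distrib]; rfl
  rw [e, star_neg, Matrix.star_mulVec, Matrix.star_mulVec, Matrix.conjTranspose_conjTranspose,
    Matrix.conjTranspose_conjTranspose, dotProduct_neg, neg_dotProduct, ← Matrix.dotProduct_mulVec,
    ← Matrix.dotProduct_mulVec, Matrix.mulVec_mulVec, Matrix.mulVec_mulVec, hAB]
  ring

namespace MetricGraph

variable {𝒱 ℰ : Type*} [DecidableEq 𝒱] [Fintype ℰ] {G : MetricGraph 𝒱 ℰ}

open Classical in
/-- The vertex conditions, as a square linear system in the traces `(F, F')`: at `v` the condition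
is continuity and `s ∑ F' = r F`, and `b₀` is a distinguished edge end at `v`. -/
noncomputable def vertexSystem (v : 𝒱) (C : ∀ w, w ≠ v → SelfAdjointCondition (G.Ends w))
    (b₀ : ℰ × Bool) (s r : ℂ) :
    ((ℰ × Bool → ℂ) × (ℰ × Bool → ℂ)) →ₗ[ℂ] (ℰ × Bool → ℂ) where
  toFun z b := if h : G.endVertex b = v then
      -- The row of `b₀` carries the derivative condition, and every other end at `v` is compared
      -- with `b₀`. This gives exactly one equation per edge end.
      if b = b₀ then s * (∑ b' : G.Ends v, z.2 b') - r * z.1 b₀ else z.1 b - z.1 b₀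
    else ((C _ h).A *ᵥ (fun b' => z.1 b') + (C _ h).B *ᵥ (fun b' => z.2 b')) ⟨b, rfl⟩
  map_add' z z' := by
    ext b
    simp only [Prod.fst_add, Prod.snd_add, Pi.add_apply, Finset.sum_add_distrib]
    split_ifs with h h'
    · ring
    · ring
    · simp only [Matrix.mulVec, dotProduct, mul_add, Finset.sum_add_distrib]
      ring
  map_smul' a z := by
    ext b
    simp only [Prod.smul_fst, Prod.smul_snd, Pi.smul_apply, smul_eq_mul, RingHom.id_apply,
      Pi.add_apply, ← Finset.mul_sum]
    split_ifs with h h'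
    · ring
    · ring
    · simp only [Matrix.mulVec, dotProduct, mul_left_comm _ a, ← Finset.mul_sum]
      ring

/-- The hypothesis on `b₀` places it at `v` only if some end lies there. If none does, the condition
at `v` is empty and `fv = 0` serves. -/
theorem vertexSystem_eq_zero_iff {v : 𝒱} (C : ∀ w, w ≠ v → SelfAdjointCondition (G.Ends w))
    {b₀ : ℰ × Bool} (hb₀ : ∀ b, G.endVertex b = v → G.endVertex b₀ = v) (s r : ℂ)
    (z : (ℰ × Bool → ℂ) × (ℰ × Bool → ℂ)) :
    vertexSystem v C b₀ s r z = 0 ↔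
      (∀ w (hw : w ≠ v),
        (C w hw).A *ᵥ (fun b => z.1 b) + (C w hw).B *ᵥ (fun b => z.2 b) = 0) ∧
      ∃ fv : ℂ, (∀ b : G.Ends v, z.1 b = fv) ∧ s * (∑ b : G.Ends v, z.2 b) = r * fv := by
  classical
  constructor
  · intro h
    refine ⟨fun w hw => ?_, ?_⟩
    · ext ⟨b, rfl⟩
      have := congrFun h b
      simp only [vertexSystem, LinearMap.coe_mk, AddHom.coe_mk, dif_neg hw] at this
      exact this
    · by_cases hne : Nonempty (G.Ends v)
      · obtain ⟨b, hb⟩ := hne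
        have hv := hb₀ b hb
        refine ⟨z.1 b₀, fun b => ?_, ?_⟩
        · by_cases hbb : b.1 = b₀
          · rw [hbb]
          · have := congrFun h b.1
            simp only [vertexSystem, LinearMap.coe_mk, AddHom.coe_mk, dif_pos b.2,
              if_neg hbb] at this
            exact sub_eq_zero.1 this
        · have := congrFun h b₀
          simp only [vertexSystem, LinearMap.coe_mk, AddHom.coe_mk, dif_pos hv, if_true] at this
          exact sub_eq_zero.1 this
      · rw [not_nonempty_iff] at hne
        exact ⟨0, fun b => isEmptyElim b, by simp⟩
  · rintro ⟨h1, fv, h2, h3⟩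
    ext b
    simp only [vertexSystem, LinearMap.coe_mk, AddHom.coe_mk, Pi.zero_apply]
    split_ifs with h h'
    · subst h'
      rw [h3, h2 ⟨b, h⟩, sub_self]
    · rw [h2 ⟨b, h⟩, h2 ⟨b₀, hb₀ b h⟩, sub_self]
    · exact congrFun (h1 _ h) ⟨b, rfl⟩

theorem sum_ends [Fintype 𝒱] (F : ℰ × Bool → ℂ) : ∑ b, F b = ∑ w, ∑ b : G.Ends w, F b :=
  (Fintype.sum_fiberwise G.endVertex F).symm

/-- Green's identity at the vertices. -/
theorem green_vertices [Fintype 𝒱] {v : 𝒱} (C : ∀ w, w ≠ v → SelfAdjointCondition (G.Ends w))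
    {F F' H H' : ℰ × Bool → ℂ}
    (hF : ∀ w (hw : w ≠ v), (C w hw).A *ᵥ (fun b => F b) + (C w hw).B *ᵥ (fun b => F' b) = 0)
    (hH : ∀ w (hw : w ≠ v), (C w hw).A *ᵥ (fun b => H b) + (C w hw).B *ᵥ (fun b => H' b) = 0)
    {fv hv : ℂ} (hfv : ∀ b : G.Ends v, F b = fv) (hhv : ∀ b : G.Ends v, H b = hv) :
    ∑ b, (starRingEnd ℂ (H b) * F' b - starRingEnd ℂ (H' b) * F b) =
      starRingEnd ℂ hv * (∑ b : G.Ends v, F' b) -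
        starRingEnd ℂ (∑ b : G.Ends v, H' b) * fv := by
  rw [sum_ends (G := G), Finset.sum_eq_single v]
  · simp only [hfv, hhv, Finset.sum_sub_distrib, Finset.mul_sum, map_sum, Finset.sum_mul]
  · intro w _ hw
    exact (C w hw).green (hF w hw) (hH w hw)
  · intro h; exact absurd (Finset.mem_univ v) h

end MetricGraph

/-! ### Green's identity on an edge -/

section EdgeGreen

variable {ℓ : ℝ} (hℓ : 0 ≤ ℓ)

/-- The `L²` inner product on an edge, antilinear in the first variable. -/
noncomputable def edgeInner (g f : EdgeFun ℓ) : ℂ :=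
  ∫ x in (0 : ℝ)..ℓ, starRingEnd ℂ (edgeExtend hℓ g x) * edgeExtend hℓ f x

theorem continuous_edgeInner :
    Continuous fun z : EdgeFun ℓ × EdgeFun ℓ => edgeInner hℓ z.1 z.2 := by
  refine intervalIntegral.continuous_parametric_intervalIntegral_of_continuous' ?_ _ _
  have h1 : Continuous fun w : (EdgeFun ℓ × EdgeFun ℓ) × ℝ => edgeExtend hℓ w.1.1 w.2 :=
    (continuous_uncurry_edgeExtend hℓ).comp (continuous_fst.fst.prodMk continuous_snd)
  have h2 : Continuous fun w : (EdgeFun ℓ × EdgeFun ℓ) × ℝ => edgeExtend hℓ w.1.2 w.2 :=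
    (continuous_uncurry_edgeExtend hℓ).comp (continuous_fst.snd.prodMk continuous_snd)
  exact (Complex.continuous_conj.comp h1).mul h2

theorem intervalIntegrable_edgeInner (g f : EdgeFun ℓ) :
    IntervalIntegrable (fun x => starRingEnd ℂ (edgeExtend hℓ g x) * edgeExtend hℓ f x)
      volume 0 ℓ :=
  ((Complex.continuous_conj.comp (continuous_edgeExtend hℓ g)).mul
    (continuous_edgeExtend hℓ f)).intervalIntegrable _ _

theorem edgeInner_conj (g f : EdgeFun ℓ) :
    starRingEnd ℂ (edgeInner hℓ g f) = edgeInner hℓ f g := by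
  rw [edgeInner, edgeInner, intervalIntegral.integral_of_le hℓ, intervalIntegral.integral_of_le hℓ,
    ← integral_conj]
  simp only [map_mul, Complex.conj_conj, mul_comm]

theorem edgeInner_add (g f f' : EdgeFun ℓ) :
    edgeInner hℓ g (f + f') = edgeInner hℓ g f + edgeInner hℓ g f' := by
  simp only [edgeInner, edgeExtend_add, mul_add]
  exact intervalIntegral.integral_add (intervalIntegrable_edgeInner hℓ g f)
    (intervalIntegrable_edgeInner hℓ g f')

theorem edgeInner_smul (g f : EdgeFun ℓ) (c : ℂ) :
    edgeInner hℓ g (c • f) = c * edgeInner hℓ g f := by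
  simp only [edgeInner, edgeExtend_smul, mul_left_comm _ c]
  exact intervalIntegral.integral_const_mul _ _

theorem edgeInner_self (f : EdgeFun ℓ) :
    edgeInner hℓ f f = ((∫ x in Ioo 0 ℓ, ‖edgeExtend hℓ f x‖ ^ 2 : ℝ) : ℂ) := by
  rw [edgeInner, intervalIntegral.integral_of_le hℓ, integral_Ioc_eq_integral_Ioo,
    ← integral_complex_ofReal]
  simp only [← Complex.normSq_eq_conj_mul_self, Complex.normSq_eq_norm_sq]

/-- Green's identity on an edge. -/
theorem edge_green (V : ℝ → ℝ) (hW : IntervalIntegrable (fun x => (V x : ℂ)) volume 0 ℓ)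
    (h : EdgeFun ℓ) (c₁ c₂ : ℝ) (y₁ y₂ : ℂ × ℂ × ℂ) :
    let u := fun (c : ℝ) y => edgeSol hℓ (fun x => (V x : ℂ)) hW h c y
    let p := fun (c : ℝ) y => edgeDer hℓ (fun x => (V x : ℂ)) hW h c y
    let B := fun x => edgeExtend hℓ (p c₁ y₁) x * starRingEnd ℂ (edgeExtend hℓ (u c₂ y₂) x) -
      starRingEnd ℂ (edgeExtend hℓ (p c₂ y₂) x) * edgeExtend hℓ (u c₁ y₁) x
    B ℓ - B 0 = ((c₂ : ℂ) - c₁) * edgeInner hℓ (u c₂ y₂) (u c₁ y₁) -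
      y₁.2.2 * edgeInner hℓ (u c₂ y₂) h + starRingEnd ℂ y₂.2.2 * edgeInner hℓ h (u c₁ y₁) := by
  intro u p B
  have hu₁ := isPrimitiveOn_edgeSol hℓ (fun x => (V x : ℂ)) hW h c₁ y₁
  have hu₂ := (isPrimitiveOn_edgeSol hℓ (fun x => (V x : ℂ)) hW h c₂ y₂).star
  have hp₁ := isPrimitiveOn_edgeDer hℓ (fun x => (V x : ℂ)) hW h c₁ y₁
  have hp₂ := (isPrimitiveOn_edgeDer hℓ (fun x => (V x : ℂ)) hW h c₂ y₂).star
  have hcont : ∀ f : EdgeFun ℓ, ContinuousOn (edgeExtend hℓ f) (uIcc 0 ℓ) := fun f =>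
    (continuous_edgeExtend hℓ f).continuousOn
  have hcont' : ∀ f : EdgeFun ℓ,
      ContinuousOn (fun x => starRingEnd ℂ (edgeExtend hℓ f x)) (uIcc 0 ℓ) := fun f =>
    (Complex.continuous_conj.comp (continuous_edgeExtend hℓ f)).continuousOn
  have h1 := hp₁.integral_mul_add hℓ hu₂
  have h2 := hp₂.integral_mul_add hℓ hu₁
  have i1 := (hp₁.1.mul_continuousOn (hcont' (u c₂ y₂))).add
    (hu₂.1.continuousOn_mul (hcont (p c₁ y₁)))
  have i2 := (hp₂.1.mul_continuousOn (hcont (u c₁ y₁))).add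
    (hu₁.1.continuousOn_mul (hcont' (p c₂ y₂)))
  have h3 := intervalIntegral.integral_sub i1 i2
  have h4 : ∫ x in (0 : ℝ)..ℓ,
      (((c₂ : ℂ) - c₁) * (starRingEnd ℂ (edgeExtend hℓ (u c₂ y₂) x) * edgeExtend hℓ (u c₁ y₁) x) -
      y₁.2.2 * (starRingEnd ℂ (edgeExtend hℓ (u c₂ y₂) x) * edgeExtend hℓ h x) +
      starRingEnd ℂ y₂.2.2 * (starRingEnd ℂ (edgeExtend hℓ h x) * edgeExtend hℓ (u c₁ y₁) x)) =
      ((c₂ : ℂ) - c₁) * edgeInner hℓ (u c₂ y₂) (u c₁ y₁) -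
      y₁.2.2 * edgeInner hℓ (u c₂ y₂) h + starRingEnd ℂ y₂.2.2 * edgeInner hℓ h (u c₁ y₁) := by
    have j1 := (intervalIntegrable_edgeInner hℓ (u c₂ y₂) (u c₁ y₁)).const_mul ((c₂ : ℂ) - c₁)
    have j2 := (intervalIntegrable_edgeInner hℓ (u c₂ y₂) h).const_mul y₁.2.2
    have j3 := (intervalIntegrable_edgeInner hℓ h (u c₁ y₁)).const_mul (starRingEnd ℂ y₂.2.2)
    rw [intervalIntegral.integral_add (j1.sub j2) j3, intervalIntegral.integral_sub j1 j2]
    simp only [intervalIntegral.integral_const_mul, edgeInner]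
  rw [← h4]
  have h5 : B ℓ - B 0 = (edgeExtend hℓ (p c₁ y₁) ℓ * starRingEnd ℂ (edgeExtend hℓ (u c₂ y₂) ℓ) -
      edgeExtend hℓ (p c₁ y₁) 0 * starRingEnd ℂ (edgeExtend hℓ (u c₂ y₂) 0)) -
      (starRingEnd ℂ (edgeExtend hℓ (p c₂ y₂) ℓ) * edgeExtend hℓ (u c₁ y₁) ℓ -
      starRingEnd ℂ (edgeExtend hℓ (p c₂ y₂) 0) * edgeExtend hℓ (u c₁ y₁) 0) := by
    simp only [B]; ring
  rw [h5, ← h1, ← h2]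
  -- The products of derivatives cancel, and so do the potential terms, `V` being real.
  refine h3.symm.trans (intervalIntegral.integral_congr fun x _ => ?_)
  simp only [edgeDer2, map_sub, map_mul, Complex.conj_ofReal, u]
  ring

end EdgeGreen

/-! ### The bordered system on the graph -/

namespace MetricGraph

variable {𝒱 ℰ : Type*} {G : MetricGraph 𝒱 ℰ} {V : ℰ → ℝ → ℝ}

/-- Initial values at the ends `0` of the edges, and the bordering unknown. -/
abbrev Coef (ℰ : Type*) : Type _ := (ℰ → ℂ) × (ℰ → ℂ) × ℂ

/-- Values and inward derivatives at the edge ends. -/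
abbrev Trace (ℰ : Type*) : Type _ := (ℰ × Bool → ℂ) × (ℰ × Bool → ℂ)

/-- The bordering unknown, as a linear form. -/
noncomputable def borderForm (ℰ : Type*) : Coef ℰ →L[ℂ] ℂ :=
  (ContinuousLinearMap.snd ℂ (ℰ → ℂ) ℂ).comp (ContinuousLinearMap.snd ℂ (ℰ → ℂ) ((ℰ → ℂ) × ℂ))

theorem borderForm_apply {ℰ : Type*} (y : Coef ℰ) : borderForm ℰ y = y.2.2 := rfl

section Solutions

variable (hV : ∀ e, IntervalIntegrable (fun x => (V e x : ℂ)) volume 0 (G.len e))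
  (h : ∀ e, EdgeFun (G.len e))

/-- The solution of `-u'' + V u = c u + m h` on all the edges. -/
noncomputable def graphSol (c : ℝ) : Coef ℰ →ₗ[ℂ] ∀ e, EdgeFun (G.len e) where
  toFun y e := edgeSol (G.len_pos e).le _ (hV e) (h e) c (y.1 e, y.2.1 e, y.2.2)
  map_add' y z := funext fun e => map_add (edgeSol (G.len_pos e).le _ (hV e) (h e) c)
    (y.1 e, y.2.1 e, y.2.2) (z.1 e, z.2.1 e, z.2.2)
  map_smul' r y := funext fun e => map_smul (edgeSol (G.len_pos e).le _ (hV e) (h e) c) r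
    (y.1 e, y.2.1 e, y.2.2)

/-- The derivative of `graphSol`. -/
noncomputable def graphDer (c : ℝ) : Coef ℰ →ₗ[ℂ] ∀ e, EdgeFun (G.len e) where
  toFun y e := edgeDer (G.len_pos e).le _ (hV e) (h e) c (y.1 e, y.2.1 e, y.2.2)
  map_add' y z := funext fun e => map_add (edgeDer (G.len_pos e).le _ (hV e) (h e) c)
    (y.1 e, y.2.1 e, y.2.2) (z.1 e, z.2.1 e, z.2.2)
  map_smul' r y := funext fun e => map_smul (edgeDer (G.len_pos e).le _ (hV e) (h e) c) r
    (y.1 e, y.2.1 e, y.2.2)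

/-- The continuous extension to `ℝ` of the `e`-th component. -/
noncomputable def component (u : ∀ e, EdgeFun (G.len e)) (e : ℰ) : ℝ → ℂ :=
  edgeExtend (G.len_pos e).le (u e)

theorem continuous_component (e : ℰ) (x : ℝ) :
    Continuous fun u : ∀ e, EdgeFun (G.len e) => component u e x :=
  Continuous.comp (g := fun z : EdgeFun (G.len e) × ℝ => edgeExtend (G.len_pos e).le z.1 z.2)
    (f := fun u : ∀ e, EdgeFun (G.len e) => (u e, x)) (continuous_uncurry_edgeExtend _)
    ((continuous_apply e).prodMk continuous_const)

theorem component_add (u w : ∀ e, EdgeFun (G.len e)) (e : ℰ) (x : ℝ) :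
    component (u + w) e x = component u e x + component w e x := rfl

theorem component_smul (c : ℂ) (u : ∀ e, EdgeFun (G.len e)) (e : ℰ) (x : ℝ) :
    component (c • u) e x = c * component u e x := rfl

/-- Values and inward derivatives of `graphSol`. -/
noncomputable def graphTrace (c : ℝ) : Coef ℰ →ₗ[ℂ] Trace ℰ where
  toFun y := (fun b => if b.2 then component (graphSol hV h c y) b.1 (G.len b.1)
      else component (graphSol hV h c y) b.1 0,
    fun b => if b.2 then -component (graphDer hV h c y) b.1 (G.len b.1)
      else component (graphDer hV h c y) b.1 0)
  map_add' y z := by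
    refine Prod.ext ?_ ?_ <;> ext ⟨e, b⟩ <;> cases b <;>
      simp [map_add, component_add, add_comm]
  map_smul' r y := by
    refine Prod.ext ?_ ?_ <;> ext ⟨e, b⟩ <;> cases b <;> simp [map_smul, component_smul]

theorem continuous_graphSol_left (y : Coef ℰ) : Continuous fun c => graphSol hV h c y :=
  continuous_pi fun e => (continuous_edgeSol (G.len_pos e).le _ (hV e) (h e) _).comp
    Complex.continuous_ofReal

theorem continuous_graphDer_left (y : Coef ℰ) : Continuous fun c => graphDer hV h c y :=
  continuous_pi fun e => (continuous_edgeDer (G.len_pos e).le _ (hV e) (h e) _).comp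
    Complex.continuous_ofReal

theorem continuous_graphTrace_left (y : Coef ℰ) : Continuous fun c => graphTrace hV h c y := by
  refine Continuous.prodMk (continuous_pi fun b => ?_) (continuous_pi fun b => ?_)
  · rcases b with ⟨e, b⟩
    cases b
    · exact (continuous_component e _).comp (continuous_graphSol_left hV h y)
    · exact (continuous_component e _).comp (continuous_graphSol_left hV h y)
  · rcases b with ⟨e, b⟩
    cases b
    · exact (continuous_component e _).comp (continuous_graphDer_left hV h y)
    · exact ((continuous_component e _).comp (continuous_graphDer_left hV h y)).neg

variable [Fintype ℰ]

/-- On a finite-dimensional space, pointwise continuity of a family of linear maps is continuity in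
operator norm, which gives joint continuity. -/
theorem continuous_uncurry_of_linear {F E : Type*} [NormedAddCommGroup F] [NormedSpace ℂ F]
    [FiniteDimensional ℂ F] [NormedAddCommGroup E] [NormedSpace ℂ E] {X : Type*}
    [TopologicalSpace X] {T : X → F →ₗ[ℂ] E} (hT : ∀ y, Continuous fun x => T x y) :
    Continuous fun z : X × F => T z.1 z.2 := by
  have h1 : Continuous fun x => LinearMap.toContinuousLinearMap (T x) :=
    continuous_clm_apply.2 hT
  exact (h1.comp continuous_fst).clm_apply continuous_snd

theorem continuous_graphSol : Continuous fun z : ℝ × Coef ℰ => graphSol hV h z.1 z.2 :=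
  continuous_uncurry_of_linear (continuous_graphSol_left hV h)

theorem continuous_graphTrace : Continuous fun z : ℝ × Coef ℰ => graphTrace hV h z.1 z.2 :=
  continuous_uncurry_of_linear (continuous_graphTrace_left hV h)

/-- The inner product of `L²(Γ)`. -/
noncomputable def graphInner (g f : ∀ e, EdgeFun (G.len e)) : ℂ :=
  ∑ e, edgeInner (G.len_pos e).le (g e) (f e)

theorem continuous_graphInner : Continuous fun z : (∀ e, EdgeFun (G.len e)) ×
    (∀ e, EdgeFun (G.len e)) => graphInner z.1 z.2 :=
  continuous_finsetSum _ fun e _ => Continuous.comp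
    (g := fun z : EdgeFun (G.len e) × EdgeFun (G.len e) => edgeInner (G.len_pos e).le z.1 z.2)
    (f := fun z : (∀ e, EdgeFun (G.len e)) × (∀ e, EdgeFun (G.len e)) => (z.1 e, z.2 e))
    (continuous_edgeInner _) (((continuous_apply e).comp continuous_fst).prodMk
      ((continuous_apply e).comp continuous_snd))

theorem graphInner_conj (g f : ∀ e, EdgeFun (G.len e)) :
    starRingEnd ℂ (graphInner g f) = graphInner f g := by
  simp only [graphInner, map_sum, edgeInner_conj]

/-- The inner product with a fixed function, as a linear form. -/
noncomputable def graphInnerForm (g : ∀ e, EdgeFun (G.len e)) :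
    (∀ e, EdgeFun (G.len e)) →ₗ[ℂ] ℂ where
  toFun f := graphInner g f
  map_add' f f' := by
    simp only [graphInner, Pi.add_apply, edgeInner_add, Finset.sum_add_distrib]
  map_smul' c f := by
    simp only [graphInner, Pi.smul_apply, edgeInner_smul, ← Finset.mul_sum, RingHom.id_apply,
      smul_eq_mul]

/-- Green's identity on the graph. -/
theorem graph_green (c₁ c₂ : ℝ) (y₁ y₂ : Coef ℰ) :
    ∑ b, (starRingEnd ℂ ((graphTrace hV h c₂ y₂).1 b) * (graphTrace hV h c₁ y₁).2 b -
      starRingEnd ℂ ((graphTrace hV h c₂ y₂).2 b) * (graphTrace hV h c₁ y₁).1 b) =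
    ((c₁ : ℂ) - c₂) * graphInner (graphSol hV h c₂ y₂) (graphSol hV h c₁ y₁) +
      y₁.2.2 * graphInner (graphSol hV h c₂ y₂) h -
      starRingEnd ℂ y₂.2.2 * graphInner h (graphSol hV h c₁ y₁) := by
  rw [Fintype.sum_prod_type]
  simp only [graphInner, Finset.mul_sum, ← Finset.sum_add_distrib, ← Finset.sum_sub_distrib]
  refine Finset.sum_congr rfl fun e _ => ?_
  have hg := edge_green (G.len_pos e).le (V e) (hV e) (h e) c₁ c₂ (y₁.1 e, y₁.2.1 e, y₁.2.2)
    (y₂.1 e, y₂.2.1 e, y₂.2.2)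
  rw [Fintype.sum_bool]
  simp only [graphTrace, LinearMap.coe_mk, AddHom.coe_mk, if_true, Bool.false_eq_true, if_false,
    component, graphSol, graphDer, map_neg] at hg ⊢
  linear_combination -hg

/-- The bordered linear system: vertex conditions `R t`, and the inner product with `h`. -/
noncomputable def borderedMap (R : ℝ → Trace ℰ →ₗ[ℂ] (ℰ × Bool → ℂ)) (p : ℝ × ℝ) :
    Coef ℰ →L[ℂ] (ℰ × Bool → ℂ) × ℂ :=
  LinearMap.toContinuousLinearMap
    ((R p.2 ∘ₗ graphTrace hV h p.1).prod (graphInnerForm h ∘ₗ graphSol hV h p.1))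

theorem borderedMap_apply (R : ℝ → Trace ℰ →ₗ[ℂ] (ℰ × Bool → ℂ)) (p : ℝ × ℝ) (y : Coef ℰ) :
    borderedMap hV h R p y =
      (R p.2 (graphTrace hV h p.1 y), graphInner h (graphSol hV h p.1 y)) := rfl

theorem continuous_borderedMap {R : ℝ → Trace ℰ →ₗ[ℂ] (ℰ × Bool → ℂ)}
    (hR : ∀ z, Continuous fun t => R t z) : Continuous (borderedMap hV h R) := by
  refine continuous_clm_apply.2 fun y => ?_
  have h1 : Continuous fun p : ℝ × ℝ => R p.2 (graphTrace hV h p.1 y) :=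
    Continuous.comp (g := fun z : ℝ × Trace ℰ => R z.1 z.2)
      (f := fun p : ℝ × ℝ => (p.2, graphTrace hV h p.1 y)) (continuous_uncurry_of_linear hR)
      (continuous_snd.prodMk ((continuous_graphTrace_left hV h y).comp continuous_fst))
  have h2 : Continuous fun p : ℝ × ℝ => graphInner h (graphSol hV h p.1 y) :=
    Continuous.comp (g := fun z : (∀ e, EdgeFun (G.len e)) × (∀ e, EdgeFun (G.len e)) =>
      graphInner z.1 z.2) (f := fun p : ℝ × ℝ => (h, graphSol hV h p.1 y)) continuous_graphInner
      (continuous_const.prodMk ((continuous_graphSol_left hV h y).comp continuous_fst))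
  exact h1.prodMk h2

theorem continuous_graphInner_graphSol : Continuous fun z : (ℝ × Coef ℰ) × (ℝ × Coef ℰ) =>
    graphInner (graphSol hV h z.1.1 z.1.2) (graphSol hV h z.2.1 z.2.2) := by
  have h1 : Continuous fun z : (ℝ × Coef ℰ) × (ℝ × Coef ℰ) => graphSol hV h z.1.1 z.1.2 :=
    Continuous.comp (g := fun z : ℝ × Coef ℰ => graphSol hV h z.1 z.2) (continuous_graphSol hV h)
      continuous_fst
  have h2 : Continuous fun z : (ℝ × Coef ℰ) × (ℝ × Coef ℰ) => graphSol hV h z.2.1 z.2.2 :=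
    Continuous.comp (g := fun z : ℝ × Coef ℰ => graphSol hV h z.1 z.2) (continuous_graphSol hV h)
      continuous_snd
  exact Continuous.comp (g := fun z : (∀ e, EdgeFun (G.len e)) × (∀ e, EdgeFun (G.len e)) =>
      graphInner z.1 z.2)
    (f := fun z : (ℝ × Coef ℰ) × (ℝ × Coef ℰ) =>
      (graphSol hV h z.1.1 z.1.2, graphSol hV h z.2.1 z.2.2))
    continuous_graphInner (h1.prodMk h2)

/-- The normalisation `⟨h, u⟩ = N`, with `N` real, turns both source terms of `graph_green` into
multiples of `N`. -/
theorem borderedFamily {R : ℝ → Trace ℰ →ₗ[ℂ] (ℰ × Bool → ℂ)} {Q : Trace ℰ → ℂ}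
    (hR : ∀ z, Continuous fun t => R t z) (hQ : Continuous Q)
    (hgreen : ∀ (t s : ℝ) (z z' : Trace ℰ), R t z = 0 → R s z' = 0 →
      ∑ b, (starRingEnd ℂ (z'.1 b) * z.2 b - starRingEnd ℂ (z'.2 b) * z.1 b) =
        ((t : ℂ) - s) * (starRingEnd ℂ (Q z') * Q z)) {N : ℝ} (hN : 0 < N) :
    BorderedFamily (borderedMap hV h R) (borderForm ℰ)
      (fun z w => graphInner (graphSol hV h z.1 z.2) (graphSol hV h w.1 w.2))
      (fun z => Q (graphTrace hV h z.1 z.2)) N where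
  continuous_J := continuous_borderedMap hV h hR
  continuous_ip := continuous_graphInner_graphSol hV h
  continuous_q := hQ.comp (continuous_graphTrace hV h)
  pos := hN
  green := by
    intro p p' y y' hy hy'
    rw [borderedMap_apply, Prod.mk.injEq] at hy hy'
    rw [← hgreen _ _ _ _ hy.1 hy'.1, graph_green, ← graphInner_conj h, hy.2, hy'.2,
      Complex.conj_ofReal, borderForm_apply, borderForm_apply]
    ring

/-- Unknowns and equations both number `2|E| + 1`. -/
theorem mem_regular_of_injective {R : ℝ → Trace ℰ →ₗ[ℂ] (ℰ × Bool → ℂ)} {p : ℝ × ℝ}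
    (hinj : ∀ y, borderedMap hV h R p y = 0 → y = 0) :
    p ∈ BorderedFamily.regular (borderedMap hV h R) := by
  have hi : Function.Injective (borderedMap hV h R p).toLinearMap :=
    (injective_iff_map_eq_zero _).2 hinj
  have hd : Module.finrank ℂ (Coef ℰ) = Module.finrank ℂ ((ℰ × Bool → ℂ) × ℂ) := by
    simp only [Module.finrank_prod, Module.finrank_fintype_fun_eq_card, Module.finrank_self,
      Fintype.card_prod, Fintype.card_bool]
    ring
  refine ⟨(LinearMap.linearEquivOfInjective _ hi hd).toContinuousLinearEquiv, ?_⟩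
  exact ContinuousLinearMap.ext fun y => rfl

end Solutions

end MetricGraph

/-! ### Eigenfunctions as solutions of the bordered system -/

namespace MetricGraph

variable {𝒱 ℰ : Type*} {G : MetricGraph 𝒱 ℰ} {V : ℰ → ℝ → ℝ}

theorem intervalIntegrable_of_memLp_two {E : Type*} [NormedAddCommGroup E] {ℓ : ℝ} (hℓ : 0 ≤ ℓ)
    {f : ℝ → E} (hf : MemLp f 2 (volume.restrict (Ioo 0 ℓ))) : IntervalIntegrable f volume 0 ℓ := by
  rw [intervalIntegrable_iff_integrableOn_Ioo_of_le hℓ]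
  exact hf.integrable one_le_two

theorem intervalIntegrable_potential
    (hV : ∀ e, MemLp (V e) 2 (volume.restrict (Ioo 0 (G.len e)))) (e : ℰ) :
    IntervalIntegrable (fun x => (V e x : ℂ)) volume 0 (G.len e) :=
  intervalIntegrable_of_memLp_two (G.len_pos e).le (hV e).ofReal

section Solutions

variable (hV : ∀ e, MemLp (V e) 2 (volume.restrict (Ioo 0 (G.len e))))
  (h : ∀ e, EdgeFun (G.len e))

/-- `graphSol` as an element of `⨁ₑ H²(e)`. -/
noncomputable def graphSolH2 (c : ℝ) (y : Coef ℰ) : G.H2Function where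
  toFun := component (graphSol (intervalIntegrable_potential hV) h c y)
  der := component (graphDer (intervalIntegrable_potential hV) h c y)
  der2 e := edgeDer2 (G.len_pos e).le _ (intervalIntegrable_potential hV e) (h e) c
    (y.1 e, y.2.1 e, y.2.2)
  continuousOn e := (continuous_edgeExtend _ _).continuousOn
  der_continuousOn e := (continuous_edgeExtend _ _).continuousOn
  der2_memLp e := by
    have hcont : ∀ f : EdgeFun (G.len e),
        MemLp (edgeExtend (G.len_pos e).le f) 2 (volume.restrict (Ioo 0 (G.len e))) := fun f =>
      MemLp.of_bound (continuous_edgeExtend _ f).aestronglyMeasurable ‖f‖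
        (Filter.Eventually.of_forall fun x => norm_edgeExtend_le _ f x)
    refine MemLp.sub (MemLp.sub ?_ ((hcont _).const_mul _)) ((hcont _).const_mul _)
    set u := edgeSol (G.len_pos e).le _ (intervalIntegrable_potential hV e) (h e) (c : ℂ)
      (y.1 e, y.2.1 e, y.2.2)
    refine MemLp.of_le_mul (c := ‖u‖) (g := V e) (hV e)
      ((hV e).ofReal.aestronglyMeasurable.mul (continuous_edgeExtend _ u).aestronglyMeasurable)
      (Filter.Eventually.of_forall fun x => ?_)
    rw [norm_mul, mul_comm, Complex.norm_real]
    exact mul_le_mul_of_nonneg_right (norm_edgeExtend_le _ u x) (norm_nonneg _)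
  weakDeriv e := (isPrimitiveOn_edgeSol (G.len_pos e).le _ (intervalIntegrable_potential hV e)
    (h e) c _).hasWeakDerivOn (G.len_pos e).le
  weakDeriv2 e := (isPrimitiveOn_edgeDer (G.len_pos e).le _ (intervalIntegrable_potential hV e)
    (h e) c _).hasWeakDerivOn (G.len_pos e).le

/-- The values and the inward derivatives of `f` at the edge ends. -/
def H2Function.trace (f : G.H2Function) : Trace ℰ := (f.value, f.inwardDeriv)

theorem trace_graphSolH2 (c : ℝ) (y : Coef ℰ) : (graphSolH2 hV h c y).trace =
    graphTrace (intervalIntegrable_potential hV) h c y := rfl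

theorem graphSolH2_equation (c : ℝ) {y : Coef ℰ} (hy : y.2.2 = 0) (e : ℰ) (x : ℝ) :
    -(graphSolH2 hV h c y).der2 e x + (V e x : ℂ) * (graphSolH2 hV h c y).toFun e x =
      (c : ℂ) * (graphSolH2 hV h c y).toFun e x := by
  simp only [graphSolH2, edgeDer2, component, graphSol, LinearMap.coe_mk, AddHom.coe_mk, hy]
  ring

/-- The initial values of `f` at the ends `0` of the edges. -/
def H2Function.coef (f : G.H2Function) : Coef ℰ := (fun e => f.toFun e 0, fun e => f.der e 0, 0)

/-- `f` and its derivative are absolutely continuous by the du Bois-Reymond lemma, so uniqueness of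
the initial value problem applies. The bordering unknown of `f.coef` is `0`, hence `h` may be
arbitrary. -/
theorem H2Function.eq_graphSol {f : G.H2Function} {c : ℝ}
    (hf : ∀ e, ∀ᵐ x ∂(volume.restrict (Ioo 0 (G.len e))),
      -f.der2 e x + (V e x : ℂ) * f.toFun e x = (c : ℂ) * f.toFun e x)
    (e : ℰ) {x : ℝ} (hx : x ∈ Icc 0 (G.len e)) :
    f.toFun e x = component (graphSol (intervalIntegrable_potential hV) h c f.coef) e x ∧
      f.der e x = component (graphDer (intervalIntegrable_potential hV) h c f.coef) e x := by
  have h1 : IsPrimitiveOn (G.len e) (f.toFun e) (f.der e) :=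
    (f.weakDeriv e).isPrimitiveOn (G.len_pos e) (f.continuousOn e)
      ((f.der_continuousOn e).intervalIntegrable_of_Icc (G.len_pos e).le)
  have h2 : IsPrimitiveOn (G.len e) (f.der e) (f.der2 e) :=
    (f.weakDeriv2 e).isPrimitiveOn (G.len_pos e) (f.der_continuousOn e)
      (intervalIntegrable_of_memLp_two (G.len_pos e).le (f.der2_memLp e))
  refine eq_edgeSol_of_isPrimitiveOn (G.len_pos e).le _ (intervalIntegrable_potential hV e) (h e)
    (c : ℂ) h1 h2 ?_ x hx
  filter_upwards [hf e] with x hx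
  linear_combination -hx

theorem H2Function.trace_eq {f : G.H2Function} {c : ℝ}
    (hf : ∀ e, ∀ᵐ x ∂(volume.restrict (Ioo 0 (G.len e))),
      -f.der2 e x + (V e x : ℂ) * f.toFun e x = (c : ℂ) * f.toFun e x) :
    f.trace = graphTrace (intervalIntegrable_potential hV) h c f.coef := by
  have key := fun e x (hx : x ∈ Icc 0 (G.len e)) => H2Function.eq_graphSol hV h hf e hx
  refine Prod.ext ?_ ?_ <;> ext ⟨e, b⟩ <;> have hl := (G.len_pos e).le <;> cases b
  · exact (key e 0 ⟨le_rfl, hl⟩).1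
  · exact (key e _ ⟨hl, le_rfl⟩).1
  · exact (key e 0 ⟨le_rfl, hl⟩).2
  · exact congrArg Neg.neg (key e _ ⟨hl, le_rfl⟩).2

/-- The restriction to the edges of an element of `⨁ₑ H²(e)`. -/
def H2Function.edgeFun (f : G.H2Function) (e : ℰ) : EdgeFun (G.len e) :=
  EdgeFun.mk (f.toFun e) (f.continuousOn e)

theorem H2Function.component_edgeFun (f : G.H2Function) (e : ℰ) {x : ℝ}
    (hx : x ∈ Icc 0 (G.len e)) : component f.edgeFun e x = f.toFun e x :=
  edgeExtend_mk _ _ hx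

theorem H2Function.edgeFun_eq {f : G.H2Function} {c : ℝ}
    (hf : ∀ e, ∀ᵐ x ∂(volume.restrict (Ioo 0 (G.len e))),
      -f.der2 e x + (V e x : ℂ) * f.toFun e x = (c : ℂ) * f.toFun e x) :
    graphSol (intervalIntegrable_potential hV) h c f.coef = f.edgeFun := by
  funext e
  refine EdgeFun.ext_extend (G.len_pos e).le fun x hx => ?_
  exact ((H2Function.eq_graphSol hV h hf e hx).1).symm.trans (f.component_edgeFun e hx).symm

/-- If `u = 0` and `m = 0`, the derivative is constantly its initial value `b`, and `0 = u(ℓ) = b ℓ`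
forces `b = 0`. -/
theorem eq_zero_of_graphSol_eq_zero {c : ℝ} {y : Coef ℰ} (hm : y.2.2 = 0)
    (h0 : graphSol (intervalIntegrable_potential hV) h c y = 0) : y = 0 := by
  have key : ∀ e, y.1 e = 0 ∧ y.2.1 e = 0 := by
    intro e
    have hl := G.len_pos e
    have hu : edgeSol hl.le _ (intervalIntegrable_potential hV e) (h e) (c : ℂ)
      (y.1 e, y.2.1 e, y.2.2) = 0 := congrFun h0 e
    have h1 := edgeSol_zero hl.le _ (intervalIntegrable_potential hV e) (h e) (c : ℂ)
      (y.1 e, y.2.1 e, y.2.2)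
    have h2 := (isPrimitiveOn_edgeSol hl.le _ (intervalIntegrable_potential hV e) (h e) (c : ℂ)
      (y.1 e, y.2.1 e, y.2.2)).2 _ ⟨hl.le, le_rfl⟩
    have hz : ∀ x, edgeExtend hl.le (0 : EdgeFun (G.len e)) x = 0 := fun _ => rfl
    have hd : ∀ x ∈ Icc 0 (G.len e), edgeExtend hl.le (edgeDer hl.le _
        (intervalIntegrable_potential hV e) (h e) (c : ℂ) (y.1 e, y.2.1 e, y.2.2)) x = y.2.1 e := by
      intro x hx
      rw [edgeExtend_edgeDer _ _ _ _ _ _ hx]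
      simp only [edgeDer2, hu]
      simp [hm, hz]
    rw [hu, hz] at h1
    rw [hu, hz, hz, intervalIntegral.integral_congr (g := fun _ => y.2.1 e) (fun x hx =>
      hd x (by rwa [uIcc_of_le hl.le] at hx)), intervalIntegral.integral_const, sub_zero, zero_add,
      Complex.real_smul] at h2
    refine ⟨h1.symm, ?_⟩
    rcases mul_eq_zero.1 h2.symm with h3 | h3
    · exact absurd (by exact_mod_cast h3) hl.ne'
    · exact h3
  exact Prod.ext (funext fun e => (key e).1) (Prod.ext (funext fun e => (key e).2) hm)

end Solutions

theorem IsSimpleEigenvalue.exists_eq_mul {D : G.H2Function → Prop} {c : ℝ}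
    (hs : IsSimpleEigenvalue V D c) {f : G.H2Function} (hf : InEigenspace V D c f)
    (hne : ∃ e, ∃ x ∈ Icc 0 (G.len e), f.toFun e x ≠ 0) {g : G.H2Function}
    (hg : InEigenspace V D c g) :
    ∃ a : ℂ, ∀ e, ∀ x ∈ Icc 0 (G.len e), g.toFun e x = a * f.toFun e x := by
  obtain ⟨f₁, -, -, hspan⟩ := hs
  obtain ⟨a, ha⟩ := hspan f hf
  obtain ⟨b, hb⟩ := hspan g hg
  have ha0 : a ≠ 0 := by
    rintro rfl
    obtain ⟨e, x, hx, h0⟩ := hne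
    exact h0 (by rw [ha e x hx, zero_mul])
  refine ⟨b / a, fun e x hx => ?_⟩
  rw [ha e x hx, hb e x hx]
  field_simp

/-! ### Branches of simple eigenvalues for a family of vertex conditions -/

section Family

variable [Fintype ℰ]

/-- The square of the `L²(Γ)` norm. -/
noncomputable def H2Function.normSq (f : G.H2Function) : ℝ :=
  ∑ e, ∫ x in Ioo 0 (G.len e), ‖f.toFun e x‖ ^ 2

theorem H2Function.graphInner_edgeFun (f : G.H2Function) :
    graphInner f.edgeFun f.edgeFun = (f.normSq : ℂ) := by
  simp only [graphInner, edgeInner_self, H2Function.normSq, Complex.ofReal_sum]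
  refine Finset.sum_congr rfl fun e _ => ?_
  congr 1
  refine setIntegral_congr_fun measurableSet_Ioo fun x hx => ?_
  have := f.component_edgeFun e (Ioo_subset_Icc_self hx)
  simp only [component] at this
  simp only [this]

theorem H2Function.normSq_pos {f : G.H2Function}
    (hf : ∃ e, ∃ x ∈ Icc 0 (G.len e), f.toFun e x ≠ 0) : 0 < f.normSq := by
  obtain ⟨e, x, hx, hne⟩ := hf
  refine Finset.sum_pos' (fun _ _ => integral_nonneg fun _ => by positivity)
    ⟨e, Finset.mem_univ e, ?_⟩
  have hl := G.len_pos e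
  rw [← integral_Ioc_eq_integral_Ioo, ← intervalIntegral.integral_of_le hl.le]
  refine intervalIntegral.integral_pos hl ((f.continuousOn e).norm.pow 2)
    (fun _ _ => by positivity) ⟨x, hx, by positivity⟩

theorem H2Function.exists_ne_zero {f : G.H2Function} (hf : 0 < f.normSq) :
    ∃ e, ∃ x ∈ Icc 0 (G.len e), f.toFun e x ≠ 0 := by
  by_contra! h0
  refine hf.ne' (Finset.sum_eq_zero fun e _ => ?_)
  rw [setIntegral_congr_fun (g := fun _ => (0 : ℝ)) measurableSet_Ioo fun x hx => by
    simp [h0 e x (Ioo_subset_Icc_self hx)]]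
  simp

/-- A one-parameter family of self-adjoint vertex conditions: the domains `D t` are given by square
linear systems `R t` in the traces, and the functional `Q` describes how they vary with `t`. -/
structure VertexFamily (D : ℝ → G.H2Function → Prop) (R : ℝ → Trace ℰ →ₗ[ℂ] (ℰ × Bool → ℂ))
    (Q : Trace ℰ → ℂ) : Prop where
  domain_iff : ∀ t f, D t f ↔ R t f.trace = 0
  continuous_R : ∀ z, Continuous fun t => R t z
  continuous_Q : Continuous Q
  green : ∀ (t s : ℝ) (z z' : Trace ℰ), R t z = 0 → R s z' = 0 →
    ∑ b, (starRingEnd ℂ (z'.1 b) * z.2 b - starRingEnd ℂ (z'.2 b) * z.1 b) =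
      ((t : ℂ) - s) * (starRingEnd ℂ (Q z') * Q z)

namespace VertexFamily

variable {D : ℝ → G.H2Function → Prop} {R : ℝ → Trace ℰ →ₗ[ℂ] (ℰ × Bool → ℂ)} {Q : Trace ℰ → ℂ}
  (hV : ∀ e, MemLp (V e) 2 (volume.restrict (Ioo 0 (G.len e))))

theorem borderedMap_coef (hF : VertexFamily D R Q) (h : ∀ e, EdgeFun (G.len e)) {c t : ℝ}
    {f : G.H2Function} (hf : InEigenspace V (D t) c f) :
    borderedMap (intervalIntegrable_potential hV) h R (c, t) f.coef =
      (0, graphInner h f.edgeFun) := by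
  rw [borderedMap_apply, ← H2Function.trace_eq hV h hf.2, (hF.domain_iff t f).1 hf.1,
    H2Function.edgeFun_eq hV h hf.2]

/-- Let `y` solve the homogeneous system bordered by `f`. Green's identity with `f` leaves only `m
‖f‖² = 0`, so `m = 0` and `u` lies in the eigenspace. By simplicity it is a multiple of `f`; being
orthogonal to `f`, it vanishes. -/
theorem mem_regular (hF : VertexFamily D R Q) {c t : ℝ} (hs : IsSimpleEigenvalue V (D t) c)
    {f : G.H2Function} (hf : InEigenspace V (D t) c f) (hN : 0 < f.normSq) :
    (c, t) ∈
      BorderedFamily.regular (borderedMap (intervalIntegrable_potential hV) f.edgeFun R) := by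
  refine mem_regular_of_injective _ _ fun y hy => ?_
  have hbf := hF.borderedMap_coef hV f.edgeFun hf
  rw [borderedMap_apply, Prod.mk_eq_zero] at hy
  rw [borderedMap_apply, Prod.mk.injEq] at hbf
  dsimp only at hy hbf
  have hN' : (f.normSq : ℂ) ≠ 0 := by exact_mod_cast hN.ne'
  have hg := graph_green (intervalIntegrable_potential hV) f.edgeFun c c y f.coef
  rw [hF.green t t _ _ hy.1 hbf.1, H2Function.edgeFun_eq hV _ hf.2, hy.2,
    f.graphInner_edgeFun] at hg
  have hm : y.2.2 = 0 := by
    have : y.2.2 * (f.normSq : ℂ) = 0 := by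
      rw [sub_self, sub_self, zero_mul, zero_mul, mul_zero, zero_add, sub_zero] at hg
      exact hg.symm
    exact (mul_eq_zero.1 this).resolve_right hN'
  have hu : InEigenspace V (D t) c (graphSolH2 hV f.edgeFun c y) :=
    ⟨(hF.domain_iff t _).2 (by rw [trace_graphSolH2]; exact hy.1),
      fun e => Filter.Eventually.of_forall fun x => graphSolH2_equation hV _ c hm e x⟩
  obtain ⟨a, ha⟩ := hs.exists_eq_mul hf (H2Function.exists_ne_zero hN) hu
  have hua : graphSol (intervalIntegrable_potential hV) f.edgeFun c y = a • f.edgeFun := by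
    funext e
    refine EdgeFun.ext_extend (G.len_pos e).le fun x hx => ?_
    exact (ha e x hx).trans (congrArg (a * ·) (f.component_edgeFun e hx).symm)
  have ha0 : a = 0 := by
    have h1 := hy.2
    rw [hua] at h1
    have h2 : graphInner f.edgeFun (a • f.edgeFun) = a * graphInner f.edgeFun f.edgeFun :=
      map_smul (graphInnerForm f.edgeFun) a f.edgeFun
    rw [h2, f.graphInner_edgeFun] at h1
    exact (mul_eq_zero.1 h1).resolve_right hN'
  refine eq_zero_of_graphSol_eq_zero hV f.edgeFun (c := c) hm ?_
  rw [hua, ha0, zero_smul]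

theorem sol_eq_coef (hF : VertexFamily D R Q) {c t : ℝ}
    {f : G.H2Function} (hf : InEigenspace V (D t) c f) (hr : (c, t) ∈
      BorderedFamily.regular (borderedMap (intervalIntegrable_potential hV) f.edgeFun R)) :
    BorderedFamily.sol (borderedMap (intervalIntegrable_potential hV) f.edgeFun R) f.normSq (c, t)
      = f.coef := by
  refine BorderedFamily.injective_of_regular hr ?_
  rw [BorderedFamily.J_sol hr, hF.borderedMap_coef hV _ hf, f.graphInner_edgeFun]

/-- With `m = 0` the solution is an eigenfunction, nonzero because `⟨h, u⟩ = N`. Any other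
eigenfunction `g` solves the system with right side `(0, ⟨h, g⟩)`, so injectivity makes it a
multiple of the first: simplicity comes for free. -/
theorem isSimpleEigenvalue_of_regular (hF : VertexFamily D R Q) {h : ∀ e, EdgeFun (G.len e)}
    {N : ℝ} (hN : 0 < N) {c t : ℝ}
    (hr : (c, t) ∈ BorderedFamily.regular (borderedMap (intervalIntegrable_potential hV) h R))
    (hm : borderForm ℰ (BorderedFamily.sol
      (borderedMap (intervalIntegrable_potential hV) h R) N (c, t)) = 0) :
    IsSimpleEigenvalue V (D t) c := by
  have hJ := BorderedFamily.J_sol (N := N) hr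
  set y := BorderedFamily.sol (borderedMap (intervalIntegrable_potential hV) h R) N (c, t)
  have hJ' := hJ
  rw [borderedMap_apply, Prod.mk.injEq] at hJ'
  dsimp only at hJ'
  have hN' : (N : ℂ) ≠ 0 := by exact_mod_cast hN.ne'
  rw [borderForm_apply] at hm
  refine ⟨graphSolH2 hV h c y, ⟨(hF.domain_iff t _).2 (by rw [trace_graphSolH2]; exact hJ'.1),
      fun e => Filter.Eventually.of_forall fun x => graphSolH2_equation hV _ c hm e x⟩, ?_, ?_⟩
  · by_contra! h0
    have hz : graphSol (intervalIntegrable_potential hV) h c y = 0 := by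
      funext e
      exact EdgeFun.ext_extend (G.len_pos e).le fun x hx => h0 e x hx
    rw [hz] at hJ'
    exact hN' (hJ'.2.symm.trans (map_zero (graphInnerForm h)))
  · intro g hg
    have hb := hF.borderedMap_coef hV h hg
    set k : ℂ := graphInner h g.edgeFun / N
    have hy : g.coef = k • y := by
      refine BorderedFamily.injective_of_regular hr ?_
      rw [hb, map_smul, hJ]
      exact Prod.ext (smul_zero k).symm (div_mul_cancel₀ _ hN').symm
    refine ⟨k, fun e x hx => ?_⟩
    rw [(H2Function.eq_graphSol hV h hg.2 e hx).1, hy, map_smul]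
    rfl

theorem exists_branch (hF : VertexFamily D R Q)
    (hV : ∀ e, MemLp (V e) 2 (volume.restrict (Ioo 0 (G.len e)))) {c t : ℝ}
    (hs : IsSimpleEigenvalue V (D t) c) :
    ∃ (U : Set ℝ) (lam : ℝ → ℝ), t ∈ U ∧ lam t = c ∧ IsSimpleBranch V D U lam := by
  obtain ⟨f, hf, hne, -⟩ := id hs
  have hN := H2Function.normSq_pos hne
  have hr := hF.mem_regular hV hs hf hN
  have hsol := hF.sol_eq_coef hV hf hr
  have HB := borderedFamily (intervalIntegrable_potential hV) f.edgeFun hF.continuous_R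
    hF.continuous_Q hF.green hN
  obtain ⟨U, lam, hU, ht, hl, hc, hlam⟩ := HB.exists_branch hr
    (by simp only [hsol, H2Function.edgeFun_eq hV _ hf.2, f.graphInner_edgeFun])
    (by rw [hsol]; rfl)
  exact ⟨U, lam, ht, hl, hU, hc, fun s hs =>
    hF.isSimpleEigenvalue_of_regular hV hN (hlam s hs).1 (hlam s hs).2⟩

/-- The bordering function is the eigenfunction `f` at the point `t` itself, with `N = 1`.
Eigenfunctions at nearby parameters supply the null vectors with `m = 0` that place the given branch
on the zero set of `m`. -/
theorem hasDerivAt_branch (hF : VertexFamily D R Q)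
    (hV : ∀ e, MemLp (V e) 2 (volume.restrict (Ioo 0 (G.len e)))) {U : Set ℝ} {lam : ℝ → ℝ}
    (hB : IsSimpleBranch V D U lam) {t : ℝ} (ht : t ∈ U) {f : G.H2Function}
    (hf : InEigenspace V (D t) (lam t) f) (hnorm : f.Normalized) :
    HasDerivAt lam (‖Q f.trace‖ ^ 2) t := by
  obtain ⟨hU, hc, hsimple⟩ := hB
  have hN1 : f.normSq = 1 := hnorm
  have hN : 0 < f.normSq := by rw [hN1]; exact one_pos
  have hr := hF.mem_regular hV (hsimple t ht) hf hN
  have hsol := hF.sol_eq_coef hV hf hr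
  have HB := borderedFamily (intervalIntegrable_potential hV) f.edgeFun hF.continuous_R
    hF.continuous_Q hF.green hN
  have := HB.hasDerivAt_branch (lam := lam) hr
    (by simp only [hsol, H2Function.edgeFun_eq hV _ hf.2, f.graphInner_edgeFun])
    (hc.continuousAt (hU.mem_nhds ht)) (by
      filter_upwards [hU.mem_nhds ht] with s hs
      obtain ⟨g, hg, ⟨e, x, hx, hgx⟩, -⟩ := hsimple s hs
      refine ⟨g.coef, fun h0 => hgx ?_, ?_, rfl⟩
      · rw [(H2Function.eq_graphSol hV f.edgeFun hg.2 e hx).1, h0, map_zero]; rfl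
      · rw [hF.borderedMap_coef hV _ hg])
  rw [hN1, div_one] at this
  rw [hN1] at hsol
  simp only [hsol, ← H2Function.trace_eq hV _ hf.2] at this
  exact this

end VertexFamily

end Family

theorem exists_distinguished_end (v : 𝒱) (e : ℰ) :
    ∃ b₀ : ℰ × Bool, ∀ b, G.endVertex b = v → G.endVertex b₀ = v := by
  by_cases h : ∃ b, G.endVertex b = v
  · obtain ⟨b₀, hb₀⟩ := h
    exact ⟨b₀, fun _ _ => hb₀⟩
  · exact ⟨(e, false), fun b hb => absurd ⟨b, hb⟩ h⟩

theorem IsSimpleEigenvalue.nonempty {D : G.H2Function → Prop} {c : ℝ}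
    (hs : IsSimpleEigenvalue V D c) : Nonempty ℰ := by
  obtain ⟨f, -, ⟨e, -⟩, -⟩ := hs
  exact ⟨e⟩

/-! ### The two families of conditions at `v` -/

section DeltaConditions

variable [DecidableEq 𝒱] [Fintype ℰ] {v : 𝒱}
  (C : ∀ w, w ≠ v → SelfAdjointCondition (G.Ends w)) {b₀ : ℰ × Bool}

theorem continuous_vertexSystem {s r : ℝ → ℝ} (hs : Continuous s) (hr : Continuous r)
    (z : Trace ℰ) : Continuous fun t => vertexSystem v C b₀ (s t) (r t) z := by
  refine continuous_pi fun b => ?_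
  simp only [vertexSystem, LinearMap.coe_mk, AddHom.coe_mk]
  split_ifs <;> fun_prop

/-- With `∑ F' = t fv` and `∑ H' = s gv`, the contribution of `v` is `(t - s) conj(gv) fv`. The case
distinction in `Q` is for a vertex without edge ends, where `b₀` lies elsewhere and the contribution
is zero. -/
theorem vertexFamily_delta [Fintype 𝒱] (hb₀ : ∀ b, G.endVertex b = v → G.endVertex b₀ = v) :
    VertexFamily (deltaDomain v C)
      (fun t => vertexSystem v C b₀ ((1 : ℝ) : ℂ) (t : ℂ))
      (fun z => if G.endVertex b₀ = v then z.1 b₀ else 0) where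
  domain_iff t f := by
    rw [vertexSystem_eq_zero_iff C hb₀]
    simp only [Complex.ofReal_one, one_mul]
    rfl
  continuous_R := continuous_vertexSystem C continuous_const continuous_id
  continuous_Q := by split_ifs <;> fun_prop
  green t s z z' hz hz' := by
    rw [vertexSystem_eq_zero_iff C hb₀] at hz hz'
    obtain ⟨hF, fv, hfv, hS⟩ := hz
    obtain ⟨hH, gv, hgv, hS'⟩ := hz'
    rw [green_vertices C hF hH hfv hgv]
    rw [Complex.ofReal_one, one_mul] at hS hS'
    split_ifs with hv
    · rw [hfv ⟨b₀, hv⟩, hgv ⟨b₀, hv⟩, hS, hS', map_mul, Complex.conj_ofReal]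
      ring
    · have : IsEmpty (G.Ends v) := ⟨fun b => hv (hb₀ b.1 b.2)⟩
      simp

/-- Here the values are expressed by the derivative sums, `fv = -t S` and `gv = -s S'`, and the
contribution of `v` becomes `(t - s) conj(S') S`, with no division by the parameter. -/
theorem vertexFamily_zeta [Fintype 𝒱] (hb₀ : ∀ b, G.endVertex b = v → G.endVertex b₀ = v) :
    VertexFamily (zetaDomain v C)
      (fun t => vertexSystem v C b₀ (t : ℂ) ((-1 : ℝ) : ℂ))
      (fun z => ∑ b : G.Ends v, z.2 b) where
  domain_iff t f := by
    rw [vertexSystem_eq_zero_iff C hb₀]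
    simp only [Complex.ofReal_neg, Complex.ofReal_one, neg_one_mul]
    rfl
  continuous_R := continuous_vertexSystem C continuous_id continuous_const
  continuous_Q := by fun_prop
  green t s z z' hz hz' := by
    rw [vertexSystem_eq_zero_iff C hb₀] at hz hz'
    obtain ⟨hF, fv, hfv, hS⟩ := hz
    obtain ⟨hH, gv, hgv, hS'⟩ := hz'
    rw [green_vertices C hF hH hfv hgv]
    rw [Complex.ofReal_neg, Complex.ofReal_one, neg_one_mul] at hS hS'
    have e1 : fv = -((t : ℂ) * ∑ b : G.Ends v, z.2 b) := by rw [hS, neg_neg]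
    have e2 : gv = -((s : ℂ) * ∑ b : G.Ends v, z'.2 b) := by rw [hS', neg_neg]
    rw [e1, e2, map_neg, map_mul, Complex.conj_ofReal]
    ring

end DeltaConditions

end MetricGraph

theorem proposition4p2 {𝒱 ℰ : Type*} [Fintype 𝒱] [DecidableEq 𝒱] [Fintype ℰ]
    (G : MetricGraph 𝒱 ℰ) (V : ℰ → ℝ → ℝ)
    (hV : ∀ e, MemLp (V e) 2 (volume.restrict (Ioo 0 (G.len e))))
    (v : 𝒱) (C : ∀ w, w ≠ v → SelfAdjointCondition (G.Ends w)) :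
    ((∀ α₀ lam₀ : ℝ, MetricGraph.IsSimpleEigenvalue V (MetricGraph.deltaDomain v C α₀) lam₀ →
        ∃ (U : Set ℝ) (lam : ℝ → ℝ), α₀ ∈ U ∧ lam α₀ = lam₀ ∧
          MetricGraph.IsSimpleBranch V (MetricGraph.deltaDomain v C) U lam) ∧
      (∀ (U : Set ℝ) (lam : ℝ → ℝ),
        MetricGraph.IsSimpleBranch V (MetricGraph.deltaDomain v C) U lam →
        ∀ α ∈ U, ∀ f : G.H2Function,
          MetricGraph.InEigenspace V (MetricGraph.deltaDomain v C α) (lam α) f →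
          f.Normalized →
          ∀ b : G.Ends v, HasDerivAt lam (‖f.value b‖ ^ 2) α)) ∧
    ((∀ ζ₀ lam₀ : ℝ, MetricGraph.IsSimpleEigenvalue V (MetricGraph.zetaDomain v C ζ₀) lam₀ →
        ∃ (U : Set ℝ) (lam : ℝ → ℝ), ζ₀ ∈ U ∧ lam ζ₀ = lam₀ ∧
          MetricGraph.IsSimpleBranch V (MetricGraph.zetaDomain v C) U lam) ∧
      (∀ (U : Set ℝ) (lam : ℝ → ℝ),
        MetricGraph.IsSimpleBranch V (MetricGraph.zetaDomain v C) U lam →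
        ∀ ζ ∈ U, ∀ f : G.H2Function,
          MetricGraph.InEigenspace V (MetricGraph.zetaDomain v C ζ) (lam ζ) f →
          f.Normalized →
          HasDerivAt lam (‖f.sumDeriv v‖ ^ 2) ζ)) := by
  refine ⟨⟨fun α₀ lam₀ hs => ?_, fun U lam hB α hα f hf hn b => ?_⟩,
    fun ζ₀ lam₀ hs => ?_, fun U lam hB ζ hζ f hf hn => ?_⟩
  · obtain ⟨e⟩ := hs.nonempty
    obtain ⟨b₀, hb₀⟩ := MetricGraph.exists_distinguished_end (G := G) v e
    exact (MetricGraph.vertexFamily_delta C hb₀).exists_branch hV hs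
  -- Taking `b` itself as the distinguished end makes `Q` the value of `f` at `b`.
  · have h := (MetricGraph.vertexFamily_delta C (b₀ := b) fun _ _ => b.2).hasDerivAt_branch
      hV hB hα hf hn
    simp only [if_pos b.2] at h
    exact h
  · obtain ⟨e⟩ := hs.nonempty
    obtain ⟨b₀, hb₀⟩ := MetricGraph.exists_distinguished_end (G := G) v e
    exact (MetricGraph.vertexFamily_zeta C hb₀).exists_branch hV hs
  · obtain ⟨e⟩ := (hB.2.2 ζ hζ).nonempty
    obtain ⟨b₀, hb₀⟩ := MetricGraph.exists_distinguished_end (G := G) v e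
    exact (MetricGraph.vertexFamily_zeta C hb₀).hasDerivAt_branch hV hB hζ hf hn
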